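/- **Setting.** Let $n\ge 1$ and let $\Omega\subset\mathbb R^n$ be a domain (a nonempty connected open set). Functions are real-valued and Lebesgue measurable, and functions that agree almost everywhere are identified. For a measurable function $u$ on $\Omega$ and $s\in(0,1]$, let $\mathcal D^s(u)$ be the set of all measurable $g:\Omega\to[0,\infty)$ for which there is a null set $N$ such that $$|u(x)-u(y)|\le |x-y|^s\,[g(x)+g(y)]\qquad(*)$$ for all $x,y\in\Omega\setminus N$. Let $\mathcal D^s_{\rm ball}(u)$ be the set of all measurable $g:\Omega\to[0,\infty)$ for which there is a null set $N$ such that $(*)$ holds for all $x,y\in\Omega\setminus N$ with $|x-y|<\tfrac12\operatorname{dist}(x,\partial\Omega)$, where $\operatorname{dist}(x,\emptyset)=\infty$. For $p\in(0,\infty]$ put $$\|u\|_{\dot M^{s,p}(\Omega)}=\inf_{g\in\mathcal D^s(u)}\|g\|_{L^p(\Omega)},\qquad \|u\|_{\dot M^{s,p}_{\rm ball}(\Omega)}=\inf_{g\in\mathcal D^s_{\rm ball}(u)}\|g\|_{L^p(\Omega)},$$ with $\inf\emptyset=\infty$, and $$\|u\|_{M^{s,p}(\Omega)}=\|u\|_{\dot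 M^{s,p}(\Omega)}+\|u\|_{L^p(\Omega)},\qquad \|u\|_{M^{s,p}_{\rm ball}(\Omega)}=\|u\|_{\dot M^{s,p}_{\rm ball}(\Omega)}+\|u\|_{L^p(\Omega)}.$$ Each of the four spaces consists of the measurable functions whose corresponding norm is finite. For $s\in(0,1]$ and $p\in(n/s,\infty)$, $\Omega$ is an *$M^{s,p}_{\rm ball}$-imbedding domain* if $M^{s,p}_{\rm ball}(\Omega)\subset M^{s-n/p,\infty}(\Omega)$ and there is a constant $C$ with $\|u\|_{M^{s-n/p,\infty}(\Omega)}\le C\|u\|_{M^{s,p}_{\rm ball}(\Omega)}$ for all $u\in M^{s,p}_{\rm ball}(\Omega)$. It is an *$\dot M^{s,p}_{\rm ball}$-imbedding domain* if the same holds with $\dot M^{s,p}_{\rm ball}(\Omega)$ and $\dot M^{s-n/p,\infty}(\Omega)$ in place of $M^{s,p}_{\rm ball}(\Omega)$ and $M^{s-n/p,\infty}(\Omega)$. For $X=M^{s,p}_{\rm ball}$ or $X=\dot M^{s,p}_{\rm ball}$, $\Omega$ is an *$X$-extension domain* if $X(\Omega)=\{u|_\Omega:\ u\in X(\mathbb R^n)\}$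 and the norms $\|v\|_{X(\Omega)}$ and $\inf\{\|u\|_{X(\mathbb R^n)}:\ u\in X(\mathbb R^n),\ u|_\Omega=v\}$ are equivalent on this space. **Theorem 4.2.** Let $s\in(0,1]$ and $p\in(n/s,\infty)$. 1. If $\Omega$ is an $M^{s,p}_{\rm ball}$-imbedding domain, then $\Omega$ is an $M^{t,q}_{\rm ball}$-extension domain for all $t\in[s,1]$ and $q\in(n/t,\infty)$ with $t-n/q>s-n/p$. 2. If $\Omega$ is bounded and is an $\dot M^{s,p}_{\rm ball}$-imbedding domain, then $\Omega$ is an $\dot M^{t,q}_{\rm ball}$-extension domain for all $t\in[s,1]$ and $q\in(n/t,\infty)$ with $t-n/q>s-n/p$. -/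

import Mathlib

open MeasureTheory
open scoped ENNReal NNReal

noncomputable section

namespace HajlaszSobolev

/-- Euclidean space of dimension `n`. A function on a set `Ω` is represented by a function on the
whole space of which only the values at almost every point of `Ω` matter. -/
abbrev E (n : ℕ) : Type := EuclideanSpace ℝ (Fin n)

variable {n : ℕ}

/-- The class of all nonnegative measurable `g` on `Ω` for which there is a null set `N` such that
`|u x - u y| ≤ |x - y| ^ s * (g x + g y)` for all `x, y ∈ Ω \ N`. -/
def grads (s : ℝ) (Ω : Set (E n)) (u : E n → ℝ) : Set (E n → ℝ) :=
  {g | AEStronglyMeasurable g (volume.restrict Ω) ∧ (∀ x ∈ Ω, 0 ≤ g x) ∧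
    ∃ N : Set (E n), volume N = 0 ∧ ∀ x ∈ Ω \ N, ∀ y ∈ Ω \ N,
      |u x - u y| ≤ dist x y ^ s * (g x + g y)}

/-- The class of all nonnegative measurable `g` on `Ω` for which there is a null set `N` such that
`|u x - u y| ≤ |x - y| ^ s * (g x + g y)` for all `x, y ∈ Ω \ N` with
`|x - y| < (1 / 2) * dist(x, ∂Ω)`. The distance to the boundary is taken in `[0, ∞]`, so it is `∞`
when the boundary is empty, that is, when `Ω` is the whole space. -/
def ballGrads (s : ℝ) (Ω : Set (E n)) (u : E n → ℝ) : Set (E n → ℝ) :=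
  {g | AEStronglyMeasurable g (volume.restrict Ω) ∧ (∀ x ∈ Ω, 0 ≤ g x) ∧
    ∃ N : Set (E n), volume N = 0 ∧ ∀ x ∈ Ω \ N, ∀ y ∈ Ω \ N,
      edist x y < 2⁻¹ * Metric.infEDist x (frontier Ω) →
        |u x - u y| ≤ dist x y ^ s * (g x + g y)}

/-- The norm of the homogeneous Hajłasz space on `Ω`, with values in `[0, ∞]`. -/
def homNorm (s : ℝ) (p : ℝ≥0∞) (Ω : Set (E n)) (u : E n → ℝ) : ℝ≥0∞ :=
  ⨅ g ∈ grads s Ω u, eLpNorm g p (volume.restrict Ω)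

/-- The norm of the homogeneous Hajłasz space of ball type on `Ω`, with values in `[0, ∞]`. -/
def homBallNorm (s : ℝ) (p : ℝ≥0∞) (Ω : Set (E n)) (u : E n → ℝ) : ℝ≥0∞ :=
  ⨅ g ∈ ballGrads s Ω u, eLpNorm g p (volume.restrict Ω)

/-- The norm of the inhomogeneous Hajłasz space on `Ω`, with values in `[0, ∞]`. -/
def inhomNorm (s : ℝ) (p : ℝ≥0∞) (Ω : Set (E n)) (u : E n → ℝ) : ℝ≥0∞ :=
  homNorm s p Ω u + eLpNorm u p (volume.restrict Ω)

/-- The norm of the inhomogeneous Hajłasz space of ball type on `Ω`, with values in `[0, ∞]`. -/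
def inhomBallNorm (s : ℝ) (p : ℝ≥0∞) (Ω : Set (E n)) (u : E n → ℝ) : ℝ≥0∞ :=
  homBallNorm s p Ω u + eLpNorm u p (volume.restrict Ω)

/-- Given a family `X` that assigns to each set `Ω` a `[0, ∞]`-valued norm, membership in the
function space `X(Ω)`: `u` is measurable on `Ω` and its norm is finite. -/
def Mem (X : Set (E n) → (E n → ℝ) → ℝ≥0∞) (Ω : Set (E n)) (u : E n → ℝ) : Prop :=
  AEStronglyMeasurable u (volume.restrict Ω) ∧ X Ω u < ∞

/-- `Ω` supports an imbedding from `X(Ω)` to `Y(Ω)`. -/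
def SupportsImbedding (X Y : Set (E n) → (E n → ℝ) → ℝ≥0∞) (Ω : Set (E n)) : Prop :=
  (∀ u, Mem X Ω u → Mem Y Ω u) ∧ ∃ C : ℝ≥0, 0 < C ∧ ∀ u, Mem X Ω u → Y Ω u ≤ C * X Ω u

/-- `v` belongs to the restriction space `X(ℝⁿ)|_Ω`. -/
def MemRestriction (X : Set (E n) → (E n → ℝ) → ℝ≥0∞) (Ω : Set (E n)) (v : E n → ℝ) : Prop :=
  ∃ u, Mem X Set.univ u ∧ u =ᵐ[volume.restrict Ω] v

/-- The quotient norm of `X(ℝⁿ)|_Ω`: the infimum of the norms of all extensions of `v`. -/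
def restrictionNorm (X : Set (E n) → (E n → ℝ) → ℝ≥0∞) (Ω : Set (E n)) (v : E n → ℝ) : ℝ≥0∞ :=
  ⨅ (u : E n → ℝ) (_ : Mem X Set.univ u ∧ u =ᵐ[volume.restrict Ω] v), X Set.univ u

/-- `Ω` is an `X`-extension domain: `X(Ω) = X(ℝⁿ)|_Ω` with equivalent norms. -/
def IsExtensionDomain (X : Set (E n) → (E n → ℝ) → ℝ≥0∞) (Ω : Set (E n)) : Prop :=
  (∀ v, Mem X Ω v ↔ MemRestriction X Ω v) ∧
    ∃ C : ℝ≥0, 0 < C ∧ ∀ v, Mem X Ω v →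
      X Ω v ≤ C * restrictionNorm X Ω v ∧ restrictionNorm X Ω v ≤ C * X Ω v

/-- Homogeneous imbedding domains (ball type): the target is the homogeneous Hajłasz space of
smoothness `s - n / p` and integrability `∞`. -/
def IsHomBallImbeddingDomain (s p : ℝ) (Ω : Set (E n)) : Prop :=
  SupportsImbedding (homBallNorm s (ENNReal.ofReal p)) (homNorm (s - n / p) ∞) Ω

/-- Inhomogeneous imbedding domains (ball type): the target is the inhomogeneous Hajłasz space of
smoothness `s - n / p` and integrability `∞`. -/
def IsInhomBallImbeddingDomain (s p : ℝ) (Ω : Set (E n)) : Prop :=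
  SupportsImbedding (inhomBallNorm s (ENNReal.ofReal p)) (inhomNorm (s - n / p) ∞) Ω

/-- Homogeneous extension domains (ball type). -/
def IsHomBallExtensionDomain (s p : ℝ) (Ω : Set (E n)) : Prop :=
  IsExtensionDomain (homBallNorm s (ENNReal.ofReal p)) Ω

/-- Inhomogeneous extension domains (ball type). -/
def IsInhomBallExtensionDomain (s p : ℝ) (Ω : Set (E n)) : Prop :=
  IsExtensionDomain (inhomBallNorm s (ENNReal.ofReal p)) Ω

end HajlaszSobolev

end

noncomputable section

namespace HajlaszSobolev

variable {n : ℕ}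

/-! Put `α = s - n/p > 0` and choose `σ` with `t - n/σ = α`. The hypotheses on the exponents give `1
≤ σ ≤ p` and `σ < q`. A function `u` with ball gradient `F` of order `t` is studied through the
local norms `‖F‖_{L^σ(B(z,ρ))}`. Since `σ < q`, the maximal theorem bounds them by `ρ^(n/σ) m(z)`
for almost every `z`, with `‖m‖_q ≲ ‖F‖_q`.

The imbedding is used to prove a Morrey inequality for all pairs in `Ω` off a null set, `|u x - u y|
≤ C |x-y|^α ‖F‖_{L^σ(B(x, R|x-y|))}` (`TestImbedding.exists_local_morrey`). Truncate `u` affinely to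
a function with values in `[0,1]` that is `0` at `x` and `1` at `y`, and cut it off at scale `ρ =
R|x-y|`. For close pairs the classical chaining proof works (`exists_interior_morrey`).
Interpolating the resulting Hölder bound with the gradient inequality gives the test function a
gradient of order `s` with `L^p` norm `≲ ρ^(-α) + ‖F‖_{L^σ}/|u x - u y|`
(`exists_gradient_bump_mul`). The test function oscillates by `1` at distance `|x-y|`, so the
imbedding yields `1 ≲ R^(-α) + |x-y|^α ‖F‖_{L^σ}/|u x - u y|`, and a large `R` absorbs the first
term.

The extension is an infimum of McShane type, `U z = inf_y (u y + k(z,y))`, where `k(z,y)` is a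
multiple of `|z-y|^α` times a local `L^σ` norm of `F` around `z` at radius comparable to `|z-y|`
(`exists_mcshane_extension`). Smoothing the local norm by a tent makes radius times norm Lipschitz
in centre and radius. With `t ≤ 1` this gives `|U z - U w| ≤ |z-w|^t C'(m z + m w)`, so a multiple
of `m` is a gradient of `U` in `L^q`.

In the inhomogeneous case the imbedding can be tested only at scales at most `1`. A lower bound for
`|Ω ∩ B(x,ρ)|`, together with a gradient that dominates `|u|`, handles large distances and gives sup
bounds. A Lipschitz cutoff at distance `1` from `Ω` minus a null set then puts the extension in
`L^q`. -/

/-! ### The Hardy–Littlewood maximal theorem. -/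

open Set Metric in
theorem volume_ball_eq (x : E n) {r : ℝ} (hr : 0 < r) :
    volume (ball x r) = ENNReal.ofReal (r ^ n) * volume (ball (0 : E n) 1) := by
  rw [Measure.addHaar_ball_of_pos volume x hr, finrank_euclideanSpace_fin]

theorem volume_unitBall_pos : 0 < volume (Metric.ball (0 : E n) 1) :=
  Metric.measure_ball_pos _ _ one_pos

theorem volume_unitBall_ne_top : volume (Metric.ball (0 : E n) 1) ≠ ∞ :=
  measure_ball_lt_top.ne

/-- The centred Hardy–Littlewood maximal function. -/
def maximalFunction (f : E n → ℝ≥0∞) (x : E n) : ℝ≥0∞ :=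
  ⨆ (r : ℝ) (_ : 0 < r), (∫⁻ y in Metric.ball x r, f y) / volume (Metric.ball x r)

theorem lt_maximalFunction_iff {f : E n → ℝ≥0∞} {x : E n} {a : ℝ≥0∞} :
    a < maximalFunction f x ↔
      ∃ r : ℝ, 0 < r ∧ a * volume (Metric.ball x r) < ∫⁻ y in Metric.ball x r, f y := by
  simp only [maximalFunction, lt_iSup_iff]
  refine exists_congr fun r => ?_
  constructor
  · rintro ⟨hr, h⟩
    refine ⟨hr, ?_⟩
    rwa [ENNReal.lt_div_iff_mul_lt (Or.inl (Metric.measure_ball_pos _ _ hr).ne')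
      (Or.inl measure_ball_lt_top.ne)] at h
  · rintro ⟨hr, h⟩
    refine ⟨hr, ?_⟩
    rwa [ENNReal.lt_div_iff_mul_lt (Or.inl (Metric.measure_ball_pos _ _ hr).ne')
      (Or.inl measure_ball_lt_top.ne)]

theorem setLIntegral_ball_le_maximalFunction (f : E n → ℝ≥0∞) (x : E n) {r : ℝ} (hr : 0 < r) :
    ∫⁻ y in Metric.ball x r, f y ≤ maximalFunction f x * volume (Metric.ball x r) := by
  rw [← ENNReal.div_le_iff (Metric.measure_ball_pos _ _ hr).ne' measure_ball_lt_top.ne]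
  exact le_iSup₂_of_le r hr le_rfl

open Metric in
theorem exists_lt_setLIntegral_ball (f : E n → ℝ≥0∞) (x : E n) {r : ℝ} {a : ℝ≥0∞}
    (h : a < ∫⁻ y in ball x r, f y) : ∃ r' < r, a < ∫⁻ y in ball x r', f y := by
  have hU : ball x r = ⋃ k : ℕ, ball x (r - 1 / ((k : ℝ) + 1)) := by
    ext y
    simp only [mem_ball, Set.mem_iUnion]
    constructor
    · intro hy
      obtain ⟨k, hk⟩ := exists_nat_one_div_lt (sub_pos.2 hy)
      exact ⟨k, by linarith⟩
    · rintro ⟨k, hk⟩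
      have : (0 : ℝ) < 1 / ((k : ℝ) + 1) := by positivity
      linarith
  have hmono : Monotone fun k : ℕ => ball x (r - 1 / ((k : ℝ) + 1)) := by
    intro i j hij
    apply ball_subset_ball
    have : 1 / ((j : ℝ) + 1) ≤ 1 / ((i : ℝ) + 1) := by
      apply one_div_le_one_div_of_le <;> [positivity; (gcongr)]
    linarith
  rw [hU, ← withDensity_apply' , hmono.measure_iUnion, lt_iSup_iff] at h
  obtain ⟨k, hk⟩ := h
  refine ⟨r - 1 / ((k : ℝ) + 1), ?_, ?_⟩
  · have : (0 : ℝ) < 1 / ((k : ℝ) + 1) := by positivity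
    linarith
  · rwa [withDensity_apply'] at hk

open Metric in
-- A strict excess over the ball of radius `r` persists on a slightly smaller concentric ball, which
-- lies in the ball of radius `r` about every nearby centre; balls of equal radius have equal
-- volume. Thus the maximal function is lower semicontinuous.
theorem isOpen_lt_maximalFunction (f : E n → ℝ≥0∞) (a : ℝ≥0∞) :
    IsOpen {x | a < maximalFunction f x} := by
  rw [Metric.isOpen_iff]
  intro x hx
  obtain ⟨r, hr, h⟩ := lt_maximalFunction_iff.1 hx
  obtain ⟨r', hr', h'⟩ := exists_lt_setLIntegral_ball f x h
  refine ⟨r - r', by linarith, fun y hy => ?_⟩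
  refine lt_maximalFunction_iff.2 ⟨r, hr, ?_⟩
  rw [volume_ball_eq y hr, ← volume_ball_eq x hr]
  refine h'.trans_le (lintegral_mono_set ?_)
  apply ball_subset_ball'
  rw [mem_ball, dist_comm] at hy
  linarith

theorem measurable_maximalFunction (f : E n → ℝ≥0∞) : Measurable (maximalFunction f) :=
  measurable_of_Ioi fun a => (isOpen_lt_maximalFunction f a).measurableSet

open Metric in
/-- The weak type `(1, 1)` estimate for the maximal function. -/
theorem mul_volume_lt_maximalFunction_le (hn : 1 ≤ n) (f : E n → ℝ≥0∞) {a : ℝ≥0∞} (ha : a ≠ 0)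
    (ha' : a ≠ ∞) :
    a * volume {x | a < maximalFunction f x} ≤ 4 ^ n * ∫⁻ x, f x := by
  by_cases hf : ∫⁻ x, f x = ∞
  · rw [hf, ENNReal.mul_top (by positivity)]
    exact le_top
  set T := {x | a < maximalFunction f x} with hT
  have hex : ∀ x : E n, ∃ r : ℝ, x ∈ T →
      0 < r ∧ a * volume (ball x r) < ∫⁻ y in ball x r, f y := by
    intro x
    by_cases hx : x ∈ T
    · obtain ⟨r, hr⟩ := lt_maximalFunction_iff.1 hx
      exact ⟨r, fun _ => hr⟩
    · exact ⟨0, fun h => absurd h hx⟩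
  choose r hr using hex
  set V := volume (ball (0 : E n) 1) with hV
  have hV0 : V ≠ 0 := volume_unitBall_pos.ne'
  have hV1 : V ≠ ∞ := volume_unitBall_ne_top
  -- The Vitali covering lemma needs bounded radii; these are bounded because `a |B| < ∫ f < ∞`,
  -- using `r ≤ r ^ n` when `r ≥ 1`.
  have hbd : ∀ x ∈ T, r x ≤ max 1 ((∫⁻ x, f x) / (a * V)).toReal := by
    intro x hx
    obtain ⟨h0, h1⟩ := hr x hx
    rcases le_total (r x) 1 with h | h
    · exact h.trans (le_max_left _ _)
    refine le_trans ?_ (le_max_right _ _)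
    have h2 : ENNReal.ofReal (r x ^ n) ≤ (∫⁻ x, f x) / (a * V) := by
      rw [ENNReal.le_div_iff_mul_le (Or.inl (mul_ne_zero ha hV0))
        (Or.inl (ENNReal.mul_ne_top ha' hV1))]
      rw [volume_ball_eq x h0] at h1
      calc _ = a * (ENNReal.ofReal (r x ^ n) * V) := by ring
        _ ≤ _ := h1.le.trans (setLIntegral_le_lintegral _ _)
    have h3 := ENNReal.toReal_mono (ENNReal.div_ne_top hf (mul_ne_zero ha hV0)) h2
    rw [ENNReal.toReal_ofReal (by positivity)] at h3
    exact (le_self_pow₀ h (by omega)).trans h3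
  obtain ⟨u, huT, hdisj, hcov⟩ := Vitali.exists_disjoint_subfamily_covering_enlargement_ball T
    (fun x => x) r _ hbd 4 (by norm_num)
  have hcount : u.Countable := by
    refine hdisj.countable_of_isOpen (fun _ _ => isOpen_ball) fun x hx => ?_
    exact ⟨x, mem_ball_self (hr x (huT hx)).1⟩
  have hTsub : T ⊆ ⋃ b ∈ u, ball b (4 * r b) := by
    intro x hx
    obtain ⟨b, hb, hsub⟩ := hcov x hx
    exact Set.mem_biUnion hb (hsub (mem_ball_self (hr x hx).1))
  have key : ∀ b ∈ u, a * volume (ball b (4 * r b)) ≤ 4 ^ n * ∫⁻ y in ball b (r b), f y := by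
    intro b hb
    obtain ⟨h0, h1⟩ := hr b (huT hb)
    have : volume (ball b (4 * r b)) = 4 ^ n * volume (ball b (r b)) := by
      rw [volume_ball_eq b (by positivity), volume_ball_eq b h0, mul_pow,
        ENNReal.ofReal_mul (by positivity), ENNReal.ofReal_pow (by norm_num)]
      norm_num [mul_assoc]
    rw [this]
    calc _ = 4 ^ n * (a * volume (ball b (r b))) := by ring
      _ ≤ _ := by gcongr
  have : Countable u := hcount.to_subtype
  calc a * volume T ≤ a * ∑' b : u, volume (ball (b : E n) (4 * r b)) := by
        gcongr
        refine (measure_mono hTsub).trans ?_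
        rw [Set.biUnion_eq_iUnion]
        exact measure_iUnion_le _
    _ = ∑' b : u, a * volume (ball (b : E n) (4 * r b)) := ENNReal.tsum_mul_left.symm
    _ ≤ ∑' b : u, 4 ^ n * ∫⁻ y in ball (b : E n) (r b), f y :=
        ENNReal.tsum_le_tsum fun b => key b b.2
    _ = 4 ^ n * ∑' b : u, ∫⁻ y in ball (b : E n) (r b), f y := ENNReal.tsum_mul_left
    _ = 4 ^ n * ∫⁻ y in ⋃ b ∈ u, ball b (r b), f y := by
        rw [lintegral_biUnion hcount (fun _ _ => measurableSet_ball) hdisj]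
    _ ≤ _ := by gcongr; exact Measure.restrict_le_self

open Metric in
/-- The maximal function at height `2 a` only sees the part of `f` above height `a`. -/
theorem mul_volume_two_mul_lt_maximalFunction_le (hn : 1 ≤ n) {f : E n → ℝ≥0∞} (hf : Measurable f)
    {a : ℝ≥0∞} (ha : a ≠ 0) (ha' : a ≠ ∞) :
    a * volume {x | 2 * a < maximalFunction f x} ≤ 4 ^ n * ∫⁻ x in {x | a < f x}, f x := by
  have hm : MeasurableSet {x | a < f x} := measurableSet_lt measurable_const hf
  rw [← lintegral_indicator hm]
  refine le_trans ?_ (mul_volume_lt_maximalFunction_le hn _ ha ha')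
  gcongr a * volume ?_
  intro x hx
  obtain ⟨r, hr, h⟩ := lt_maximalFunction_iff.1 hx
  refine lt_maximalFunction_iff.2 ⟨r, hr, ?_⟩
  have h1 : ∫⁻ y in ball x r, f y ≤
      (∫⁻ y in ball x r, {x | a < f x}.indicator f y) + a * volume (ball x r) := by
    rw [← setLIntegral_const, ← lintegral_add_right _ measurable_const]
    refine lintegral_mono fun y => ?_
    by_cases hy : a < f y
    · rw [Set.indicator_of_mem (by exact hy)]
      exact le_self_add
    · exact (not_lt.1 hy).trans le_add_self
  have h2 := h.trans_le h1
  rw [two_mul, add_mul] at h2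
  exact lt_of_add_lt_add_right h2


/-- A function with finite `r`-th moment, `1 < r`, has a maximal function that is finite almost
everywhere. -/
theorem ae_maximalFunction_lt_top (hn : 1 ≤ n) {r : ℝ} (hr : 1 < r) {f : E n → ℝ≥0}
    (hf : Measurable f) (hfr : ∫⁻ x, (f x : ℝ≥0∞) ^ r < ∞) :
    ∀ᵐ x, maximalFunction (fun x => (f x : ℝ≥0∞)) x < ∞ := by
  set K := 4 ^ n * ∫⁻ x, (f x : ℝ≥0∞) ^ r with hK
  have hKtop : K ≠ ∞ := ENNReal.mul_ne_top (by simp) hfr.ne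
  set v := volume {x | maximalFunction (fun x => (f x : ℝ≥0∞)) x = ∞} with hv
  -- Above height `k ≥ 1` one has `f ≤ f ^ r`, so the truncated weak type bound is uniform in `k`;
  -- letting `k` grow forces `v = 0`.
  have hbound : ∀ k : ℕ, 1 ≤ k → (k : ℝ≥0∞) * v ≤ K := by
    intro k hk
    have hk1 : (1 : ℝ≥0∞) ≤ k := by exact_mod_cast hk
    have h1 := mul_volume_two_mul_lt_maximalFunction_le hn hf.coe_nnreal_ennreal
      (a := (k : ℝ≥0∞)) (by positivity) (by simp)
    refine le_trans ?_ (h1.trans ?_)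
    · gcongr _ * ?_
      refine measure_mono fun x hx => ?_
      have hx' : maximalFunction (fun x => (f x : ℝ≥0∞)) x = ∞ := hx
      change 2 * (k : ℝ≥0∞) < maximalFunction (fun x => (f x : ℝ≥0∞)) x
      rw [hx']
      exact ENNReal.mul_lt_top (by simp) (by simp)
    · rw [hK]
      gcongr _ * ?_
      refine le_trans (setLIntegral_mono' (measurableSet_lt measurable_const
        hf.coe_nnreal_ennreal) ?_) (setLIntegral_le_lintegral _ _)
      intro x hx
      exact ENNReal.le_rpow_self_of_one_le (hk1.trans (le_of_lt hx)) hr.le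
  have hv0 : v = 0 := by
    by_contra h0
    obtain ⟨k, hk⟩ := ENNReal.exists_nat_gt (ENNReal.div_ne_top hKtop h0)
    have hk1 : 1 ≤ k := by
      rcases Nat.eq_zero_or_pos k with rfl | h
      · simp at hk
      · exact h
    have hvt : v ≠ ∞ := by
      intro ht
      have := hbound 1 le_rfl
      rw [ht] at this
      simp [hKtop] at this
    rw [ENNReal.div_lt_iff (Or.inl h0) (Or.inl hvt)] at hk
    exact absurd (hbound k hk1) (not_le.2 hk)
  rw [ae_iff]
  simpa [not_lt, top_le_iff] using hv0

/-- The strong type `(r, r)` estimate for the maximal function. -/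
theorem exists_lintegral_maximalFunction_rpow_le (hn : 1 ≤ n) {r : ℝ} (hr : 1 < r) :
    ∃ C : ℝ≥0∞, C ≠ ∞ ∧ ∀ f : E n → ℝ≥0, Measurable f →
      ∫⁻ x, ENNReal.ofReal ((maximalFunction (fun x => (f x : ℝ≥0∞)) x).toReal ^ r) ≤
        C * ∫⁻ x, (f x : ℝ≥0∞) ^ r := by
  have hr1 : 0 < r - 1 := by linarith
  have hc0 : ENNReal.ofReal (r - 1) ≠ 0 := by simpa using hr
  refine ⟨ENNReal.ofReal r * (2 * 4 ^ n * ((ENNReal.ofReal (r - 1))⁻¹ *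
    ENNReal.ofReal (2 ^ (r - 1)))), ?_, fun f hf => ?_⟩
  · refine ENNReal.mul_ne_top ENNReal.ofReal_ne_top (ENNReal.mul_ne_top (by finiteness)
      (ENNReal.mul_ne_top (ENNReal.inv_ne_top.2 hc0) ENNReal.ofReal_ne_top))
  set M := maximalFunction (fun x => (f x : ℝ≥0∞)) with hM
  have hMm : Measurable M := measurable_maximalFunction _
  -- The integral of `f` over `{t < 2 f}` is a distribution function for the measure `f dx`. The
  -- layer-cake formula for `2 f` with exponent `r - 1` therefore evaluates the right-hand side of
  -- the weak type bound after integration in `t`.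
  set μ' : Measure (E n) := volume.withDensity (fun x => (f x : ℝ≥0∞)) with hμ'
  have hfr : Measurable fun x => (2 * (f x : ℝ)) := hf.coe_nnreal_real.const_mul 2
  have hlayer := lintegral_rpow_eq_lintegral_meas_lt_mul μ' (f := fun x => 2 * (f x : ℝ))
    (ae_of_all _ fun x => by positivity) hfr.aemeasurable hr1
  rw [lintegral_rpow_eq_lintegral_meas_lt_mul volume
    (ae_of_all _ fun x => ENNReal.toReal_nonneg) hMm.ennreal_toReal.aemeasurable (by linarith),
    mul_assoc]
  gcongr
  have hpt : ∀ t ∈ Set.Ioi (0 : ℝ),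
      volume {x | t < (M x).toReal} * ENNReal.ofReal (t ^ (r - 1)) ≤
      2 * 4 ^ n * (μ' {x | t < 2 * (f x : ℝ)} * ENNReal.ofReal (t ^ (r - 1 - 1))) := by
    intro t ht
    have ht0 : 0 < t := ht
    have h1 := mul_volume_two_mul_lt_maximalFunction_le hn hf.coe_nnreal_ennreal
      (a := ENNReal.ofReal (t / 2)) (by simpa using ht0) ENNReal.ofReal_ne_top
    have h2 : {x | t < (M x).toReal} ⊆ {x | 2 * ENNReal.ofReal (t / 2) < M x} := by
      intro x hx
      have hx' : t < (M x).toReal := hx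
      have : 2 * ENNReal.ofReal (t / 2) = ENNReal.ofReal t := by
        rw [← ENNReal.ofReal_ofNat, ← ENNReal.ofReal_mul (by norm_num)]
        congr 1
        ring
      change 2 * ENNReal.ofReal (t / 2) < M x
      rw [this]
      -- Where the maximal function is `∞` its `toReal` is `0`, so such points are not in the set;
      -- `ae_maximalFunction_lt_top` shows separately that they are negligible.
      exact ENNReal.ofReal_lt_iff_lt_toReal ht0.le (fun h => by
        rw [h, ENNReal.toReal_top] at hx'; linarith) |>.2 hx'
    have h3 : {x | ENNReal.ofReal (t / 2) < (f x : ℝ≥0∞)} = {x | t < 2 * (f x : ℝ)} := by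
      ext x
      simp only [Set.mem_ofPred_eq]
      rw [ENNReal.ofReal_lt_iff_lt_toReal (by positivity) ENNReal.coe_ne_top, ENNReal.coe_toReal]
      constructor <;> intro h <;> linarith
    have h4 : ∫⁻ x in {x | ENNReal.ofReal (t / 2) < (f x : ℝ≥0∞)}, (f x : ℝ≥0∞) =
        μ' {x | t < 2 * (f x : ℝ)} := by
      rw [h3, hμ', withDensity_apply']
    rw [h4] at h1
    have h5 : ENNReal.ofReal (t ^ (r - 1)) =
        2 * ENNReal.ofReal (t ^ (r - 1 - 1)) * ENNReal.ofReal (t / 2) := by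
      rw [← ENNReal.ofReal_ofNat, ← ENNReal.ofReal_mul (by norm_num),
        ← ENNReal.ofReal_mul (by positivity)]
      congr 1
      rw [Real.rpow_sub_one ht0.ne' (r - 1)]
      field_simp
    calc volume {x | t < (M x).toReal} * ENNReal.ofReal (t ^ (r - 1))
        ≤ volume {x | 2 * ENNReal.ofReal (t / 2) < M x} * ENNReal.ofReal (t ^ (r - 1)) := by
          gcongr
      _ = 2 * ENNReal.ofReal (t ^ (r - 1 - 1)) * (ENNReal.ofReal (t / 2) *
          volume {x | 2 * ENNReal.ofReal (t / 2) < M x}) := by rw [h5]; ring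
      _ ≤ 2 * ENNReal.ofReal (t ^ (r - 1 - 1)) * (4 ^ n * μ' {x | t < 2 * (f x : ℝ)}) := by
          gcongr
      _ = _ := by ring
  refine (setLIntegral_mono' measurableSet_Ioi hpt).trans ?_
  rw [lintegral_const_mul' _ _ (by finiteness), mul_assoc (2 * 4 ^ n : ℝ≥0∞)]
  gcongr _ * ?_
  have h6 : ∫⁻ t in Set.Ioi (0 : ℝ),
      μ' {x | t < 2 * (f x : ℝ)} * ENNReal.ofReal (t ^ (r - 1 - 1)) =
      (ENNReal.ofReal (r - 1))⁻¹ * ∫⁻ x, ENNReal.ofReal ((2 * (f x : ℝ)) ^ (r - 1)) ∂μ' := by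
    rw [hlayer, ← mul_assoc, ENNReal.inv_mul_cancel hc0 ENNReal.ofReal_ne_top, one_mul]
  rw [h6, mul_assoc]
  gcongr _ * ?_
  rw [hμ', lintegral_withDensity_eq_lintegral_mul₀ hf.coe_nnreal_ennreal.aemeasurable
    (hfr.pow_const _).ennreal_ofReal.aemeasurable,
    ← lintegral_const_mul' _ _ ENNReal.ofReal_ne_top]
  refine lintegral_mono fun x => le_of_eq ?_
  simp only [Pi.mul_apply]
  rw [Real.mul_rpow (by norm_num) (by positivity), ENNReal.ofReal_mul (by positivity),
    ← ENNReal.ofReal_rpow_of_nonneg (f x).coe_nonneg hr1.le, ENNReal.ofReal_coe_nnreal]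
  rcases eq_or_ne (f x) 0 with h0 | h0
  · simp [h0, (by linarith : 0 < r)]
  · rw [mul_left_comm]
    congr 1
    nth_rewrite 1 [← ENNReal.rpow_one (f x : ℝ≥0∞)]
    rw [← ENNReal.rpow_add _ _ (by simpa using h0) ENNReal.coe_ne_top]
    congr 1
    ring

/-! ### Local `L^σ` norms and their maximal majorant. -/

/-- The `L^σ` norm of `F` on the ball with centre `z` and radius `ρ`. -/
def locNorm (σ : ℝ) (F : E n → ℝ) (z : E n) (ρ : ℝ) : ℝ :=
  (eLpNorm F (ENNReal.ofReal σ) (volume.restrict (Metric.ball z ρ))).toReal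

theorem locNorm_nonneg (σ : ℝ) (F : E n → ℝ) (z : E n) (ρ : ℝ) : 0 ≤ locNorm σ F z ρ :=
  ENNReal.toReal_nonneg

theorem memLp_restrict_ball {σ q : ℝ} (hσq : σ ≤ q) {F : E n → ℝ}
    (hF : MemLp F (ENNReal.ofReal q) volume) (z : E n) (ρ : ℝ) :
    MemLp F (ENNReal.ofReal σ) (volume.restrict (Metric.ball z ρ)) :=
  have : IsFiniteMeasure (volume.restrict (Metric.ball z ρ)) :=
    isFiniteMeasure_restrict.2 measure_ball_lt_top.ne
  (hF.restrict _).mono_exponent (ENNReal.ofReal_le_ofReal hσq)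

theorem locNorm_mono {σ : ℝ} {F : E n → ℝ} {z z' : E n} {ρ ρ' : ℝ}
    (hF : MemLp F (ENNReal.ofReal σ) (volume.restrict (Metric.ball z' ρ')))
    (h : ρ + dist z z' ≤ ρ') : locNorm σ F z ρ ≤ locNorm σ F z' ρ' :=
  ENNReal.toReal_mono hF.eLpNorm_ne_top
    (eLpNorm_mono_measure _ (Measure.restrict_mono (Metric.ball_subset_ball' h) le_rfl))

theorem eLpNorm_eq_lintegral_enorm_rpow {α : Type*} [MeasurableSpace α] {μ : Measure α} {σ : ℝ}
    (hσ : 0 < σ) (F : α → ℝ) :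
    eLpNorm F (ENNReal.ofReal σ) μ = (∫⁻ x, ‖F x‖ₑ ^ σ ∂μ) ^ (1 / σ) := by
  rw [eLpNorm_eq_lintegral_rpow_enorm_toReal (by simpa using hσ) ENNReal.ofReal_ne_top,
    ENNReal.toReal_ofReal hσ.le]

/-- Somewhere on `S`, the values of `F` do not exceed the `L^σ` mean over `S`. -/
theorem exists_abs_mul_le_locNorm {σ : ℝ} (hσ : 0 < σ) {F : E n → ℝ} {z : E n} {ρ : ℝ}
    (hF : MemLp F (ENNReal.ofReal σ) (volume.restrict (Metric.ball z ρ))) {S N : Set (E n)}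
    (hS : MeasurableSet S) (hSb : S ⊆ Metric.ball z ρ) (hS0 : volume S ≠ 0) (hN : volume N = 0) :
    ∃ x ∈ S, x ∉ N ∧ |F x| * (volume S).toReal ^ (1 / σ) ≤ locNorm σ F z ρ := by
  have hStop : volume S ≠ ∞ := ((measure_mono hSb).trans_lt measure_ball_lt_top).ne
  have hmeas : AEMeasurable (fun x => ‖F x‖ₑ ^ σ) (volume.restrict S) :=
    ((hF.1.mono_measure (Measure.restrict_mono hSb le_rfl)).enorm).pow_const _
  -- Adding `Sᶜ` to the exceptional set forces the selected point to lie in `S`.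
  have hnull : volume.restrict S (N ∪ Sᶜ) = 0 := by
    refine measure_union_null ?_ ?_
    · exact le_antisymm ((Measure.restrict_apply_le _ _).trans hN.le) bot_le
    · rw [Measure.restrict_apply hS.compl]; simp
  have : IsFiniteMeasure (volume.restrict S) := isFiniteMeasure_restrict.2 hStop
  obtain ⟨x, hx, hle⟩ := exists_notMem_null_le_laverage
    (by rwa [Ne, Measure.restrict_eq_zero]) hmeas hnull
  simp only [Set.mem_union, Set.mem_compl_iff, not_or, not_not] at hx
  refine ⟨x, hx.2, hx.1, ?_⟩
  rw [setLAverage_eq, ENNReal.le_div_iff_mul_le (Or.inl hS0) (Or.inl hStop)] at hle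
  have h1 : ‖F x‖ₑ * volume S ^ (1 / σ) ≤
      eLpNorm F (ENNReal.ofReal σ) (volume.restrict (Metric.ball z ρ)) := by
    rw [eLpNorm_eq_lintegral_enorm_rpow hσ]
    have h2 : ‖F x‖ₑ * volume S ^ (1 / σ) = (‖F x‖ₑ ^ σ * volume S) ^ (1 / σ) := by
      rw [ENNReal.mul_rpow_of_nonneg _ _ (by positivity), ← ENNReal.rpow_mul,
        mul_one_div_cancel hσ.ne', ENNReal.rpow_one]
    rw [h2]
    gcongr
    exact hle.trans (lintegral_mono_set hSb)
  have h3 := ENNReal.toReal_mono hF.eLpNorm_ne_top h1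
  rwa [ENNReal.toReal_mul, toReal_enorm, Real.norm_eq_abs, ← ENNReal.toReal_rpow] at h3

/-- Local `L^σ` norms are controlled by a function whose `L^q` norm is bounded by that of `F`. -/
theorem exists_locNorm_le_rpow_mul (hn : 1 ≤ n) {σ q : ℝ} (hσ : 0 < σ) (hσq : σ < q) :
    ∃ C : ℝ≥0, ∀ F : E n → ℝ, Measurable F → MemLp F (ENNReal.ofReal q) volume →
      ∃ m : E n → ℝ, Measurable m ∧ (∀ x, 0 ≤ m x) ∧
        eLpNorm m (ENNReal.ofReal q) volume ≤ C * eLpNorm F (ENNReal.ofReal q) volume ∧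
        ∀ᵐ z, ∀ ρ : ℝ, 0 < ρ → locNorm σ F z ρ ≤ ρ ^ ((n : ℝ) / σ) * m z := by
  have hq : 0 < q := hσ.trans hσq
  have hr : 1 < q / σ := by rwa [lt_div_iff₀ hσ, one_mul]
  obtain ⟨C, hC, hmax⟩ := exists_lintegral_maximalFunction_rpow_le hn hr
  set V := (volume (Metric.ball (0 : E n) 1)).toReal with hV
  refine ⟨(ENNReal.ofReal (V ^ (1 / σ)) * C ^ (1 / q)).toNNReal, fun F hF hFq => ?_⟩
  have hConst : ENNReal.ofReal (V ^ (1 / σ)) * C ^ (1 / q) ≠ ∞ :=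
    ENNReal.mul_ne_top ENNReal.ofReal_ne_top (ENNReal.rpow_ne_top_of_nonneg (by positivity) hC)
  rw [ENNReal.coe_toNNReal hConst]
  set f : E n → ℝ≥0 := fun x => ‖F x‖₊ ^ σ with hf
  have hfm : Measurable f := hF.nnnorm.pow_const _
  have hfe : ∀ x, (f x : ℝ≥0∞) = ‖F x‖ₑ ^ σ := fun x => by
    rw [hf, ENNReal.coe_rpow_of_nonneg _ hσ.le]; rfl
  have hfr : ∀ x, (f x : ℝ≥0∞) ^ (q / σ) = ‖F x‖ₑ ^ q := fun x => by
    rw [hfe, ← ENNReal.rpow_mul]; congr 1; field_simp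
  have hFnorm := eLpNorm_eq_lintegral_enorm_rpow (μ := volume) hq F
  have hfin : ∫⁻ x, (f x : ℝ≥0∞) ^ (q / σ) < ∞ := by
    simp only [hfr]
    have := hFq.2
    rw [hFnorm] at this
    by_contra h
    rw [not_lt, top_le_iff] at h
    rw [h, ENNReal.top_rpow_of_pos (by positivity)] at this
    exact lt_irrefl _ this
  have hae := ae_maximalFunction_lt_top hn hr hfm hfin
  set M := maximalFunction (fun x => (f x : ℝ≥0∞)) with hM
  have hMm : Measurable M := measurable_maximalFunction _
  -- The majorant is `(V · M(|F|^σ))^(1/σ)`; the strong type bound with exponent `q / σ > 1`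
  -- controls its `L^q` norm.
  refine ⟨fun x => V ^ (1 / σ) * (M x).toReal ^ (1 / σ),
    (hMm.ennreal_toReal.pow_const _).const_mul _, fun x => by positivity, ?_, ?_⟩
  · have h1 : eLpNorm (fun x => V ^ (1 / σ) * (M x).toReal ^ (1 / σ)) (ENNReal.ofReal q) volume =
        ENNReal.ofReal (V ^ (1 / σ)) *
          eLpNorm (fun x => (M x).toReal ^ (1 / σ)) (ENNReal.ofReal q) volume := by
      rw [← Real.enorm_eq_ofReal (r := V ^ (1 / σ)) (by positivity), ← eLpNorm_const_smul]
      rfl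
    rw [h1, mul_assoc]
    gcongr
    rw [eLpNorm_eq_lintegral_enorm_rpow hq, hFnorm, ← ENNReal.mul_rpow_of_nonneg _ _ (by positivity)]
    gcongr
    refine le_trans (le_of_eq ?_) ((hmax f hfm).trans (le_of_eq ?_))
    · refine lintegral_congr fun x => ?_
      rw [Real.enorm_eq_ofReal (by positivity), ENNReal.ofReal_rpow_of_nonneg (by positivity) hq.le,
        ← Real.rpow_mul ENNReal.toReal_nonneg]
      congr 2
      field_simp
    · simp only [hfr]
  · filter_upwards [hae] with z hz ρ hρ
    have h1 : locNorm σ F z ρ = (∫⁻ y in Metric.ball z ρ, (f y : ℝ≥0∞)).toReal ^ (1 / σ) := by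
      rw [locNorm, eLpNorm_eq_lintegral_enorm_rpow hσ, ← ENNReal.toReal_rpow]
      simp only [hfe]
    have h2 := ENNReal.toReal_mono (ENNReal.mul_ne_top hz.ne measure_ball_lt_top.ne)
      (setLIntegral_ball_le_maximalFunction (fun x => (f x : ℝ≥0∞)) z hρ)
    rw [ENNReal.toReal_mul, volume_ball_eq z hρ, ENNReal.toReal_mul,
      ENNReal.toReal_ofReal (by positivity)] at h2
    rw [h1]
    calc _ ≤ ((M z).toReal * (ρ ^ n * V)) ^ (1 / σ) := by gcongr
      _ = _ := by
        rw [Real.mul_rpow (by positivity) (by positivity), Real.mul_rpow (by positivity)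
          (by positivity), ← Real.rpow_natCast, ← Real.rpow_mul hρ.le, mul_one_div]
        ring

/-! ### Ball gradients and the interior Morrey inequality. -/

/-- `F` is a gradient of ball type of `u` with exceptional set `N`. -/
def IsBallGrad (t : ℝ) (Ω N : Set (E n)) (u F : E n → ℝ) : Prop :=
  ∀ x ∈ Ω \ N, ∀ y ∈ Ω \ N, edist x y < 2⁻¹ * Metric.infEDist x (frontier Ω) →
    |u x - u y| ≤ dist x y ^ t * (F x + F y)

/-- The ball is connected, and a point of it in the closure of `Ω` but not in `Ω` would be a
boundary point at distance less than `δ` from `x`. -/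
theorem ball_subset_of_le_infEDist_frontier {Ω : Set (E n)} (hΩ : IsOpen Ω) {x : E n} (hx : x ∈ Ω)
    {δ : ℝ} (hδ : ENNReal.ofReal δ ≤ Metric.infEDist x (frontier Ω)) : Metric.ball x δ ⊆ Ω := by
  rcases le_or_gt δ 0 with h | h
  · simp [Metric.ball_eq_empty.2 h]
  refine (convex_ball x δ).isPreconnected.subset_of_closure_inter_subset hΩ
    ⟨x, Metric.mem_ball_self h, hx⟩ ?_
  rintro y ⟨hy, hyb⟩
  by_contra hyΩ
  have hyf : y ∈ frontier Ω := by
    rw [hΩ.frontier_eq]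
    exact ⟨hy, hyΩ⟩
  have h1 := hδ.trans (Metric.infEDist_le_edist_of_mem hyf)
  rw [edist_dist] at h1
  have h2 := (ENNReal.ofReal_le_ofReal_iff dist_nonneg).1 h1
  rw [Metric.mem_ball, dist_comm] at hyb
  linarith

theorem ofReal_two_mul_dist_lt {K : Set (E n)} {x y : E n}
    (h : edist x y < 2⁻¹ * Metric.infEDist x K) :
    ENNReal.ofReal (2 * dist x y) < Metric.infEDist x K := by
  rw [mul_comm, ← div_eq_mul_inv, ENNReal.lt_div_iff_mul_lt (by simp) (by simp), mul_comm] at h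
  rwa [ENNReal.ofReal_mul (by norm_num), ← edist_dist, ENNReal.ofReal_ofNat]

/-- The distance to `K` drops by at most `dist x p` when passing from `x` to `p`. This transfers
admissibility from the pair `x, y` to the auxiliary pairs used in chaining. -/
theorem edist_lt_of_close {K : Set (E n)} {x y p q : E n}
    (h : edist x y < 2⁻¹ * Metric.infEDist x K)
    (hpq : 2 * dist p q + dist x p ≤ 2 * dist x y) :
    edist p q < 2⁻¹ * Metric.infEDist p K := by
  have h1 := ofReal_two_mul_dist_lt h
  have h2 : Metric.infEDist x K ≤ edist x p + Metric.infEDist p K :=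
    Metric.infEDist_le_edist_add_infEDist
  have h3 : edist x p + 2 * edist p q < edist x p + Metric.infEDist p K := by
    refine lt_of_le_of_lt ?_ (h1.trans_le h2)
    have h4 : edist x p + 2 * edist p q = ENNReal.ofReal (dist x p + 2 * dist p q) := by
      rw [ENNReal.ofReal_add dist_nonneg (by positivity), ENNReal.ofReal_mul (by norm_num),
        ← edist_dist, ← edist_dist, ENNReal.ofReal_ofNat]
    rw [h4]
    exact ENNReal.ofReal_le_ofReal (by linarith)
  rw [mul_comm, ← div_eq_mul_inv, ENNReal.lt_div_iff_mul_lt (by simp) (by simp), mul_comm]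
  exact lt_of_add_lt_add_left h3

/-- In every ball there is a point outside a given null set at which `F` is at most its `L^σ` mean. -/
theorem exists_mem_ball_abs_le {σ : ℝ} (hσ : 0 < σ) :
    ∃ c : ℝ, 0 < c ∧ ∀ (F : E n → ℝ) (z : E n) (ρ : ℝ),
      MemLp F (ENNReal.ofReal σ) (volume.restrict (Metric.ball z ρ)) → ∀ N : Set (E n),
      volume N = 0 → ∀ (x : E n) (δ : ℝ), 0 < δ → δ + dist x z ≤ ρ →
      ∃ x' ∈ Metric.ball x δ, x' ∉ N ∧
        |F x'| ≤ c * δ ^ (-((n : ℝ) / σ)) * locNorm σ F z ρ := by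
  set V := (volume (Metric.ball (0 : E n) 1)).toReal with hV
  have hV0 : 0 < V := ENNReal.toReal_pos volume_unitBall_pos.ne' volume_unitBall_ne_top
  refine ⟨V ^ (-(1 / σ)), by positivity, fun F z ρ hF N hN x δ hδ hsub => ?_⟩
  obtain ⟨x', hx', hxN, h⟩ := exists_abs_mul_le_locNorm hσ hF measurableSet_ball
    (Metric.ball_subset_ball' hsub) (Metric.measure_ball_pos volume x hδ).ne' hN
  refine ⟨x', hx', hxN, ?_⟩
  rw [volume_ball_eq x hδ, ENNReal.toReal_mul, ENNReal.toReal_ofReal (by positivity),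
    Real.mul_rpow (by positivity) (by positivity), ← Real.rpow_natCast, ← Real.rpow_mul hδ.le,
    mul_one_div] at h
  rw [Real.rpow_neg hV0.le, Real.rpow_neg hδ.le, ← mul_inv, inv_mul_eq_div,
    le_div_iff₀ (by positivity), mul_comm (V ^ _)]
  exact h

/-- Chaining towards a single point. -/
theorem exists_chain_estimate {σ α : ℝ} (hσ : 0 < σ) (hα : 0 < α) :
    ∃ c : ℝ, 0 < c ∧ ∀ (u F : E n → ℝ) (N : Set (E n)) (x z : E n) (δ ρ : ℝ), volume N = 0 →
      MemLp F (ENNReal.ofReal σ) (volume.restrict (Metric.ball z ρ)) → (∀ y, 0 ≤ F y) →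
      x ∉ N → 0 < δ → δ + dist x z ≤ ρ →
      (∀ p ∈ Metric.ball x δ \ N, ∀ q ∈ Metric.ball x δ \ N,
        |u p - u q| ≤ dist p q ^ (α + n / σ) * (F p + F q)) →
      ∃ x' ∈ Metric.ball x δ, x' ∉ N ∧ F x' ≤ c * δ ^ (-((n : ℝ) / σ)) * locNorm σ F z ρ ∧
        |u x - u x'| ≤ c * δ ^ α * locNorm σ F z ρ := by
  obtain ⟨c, hc, hav⟩ := exists_mem_ball_abs_le (n := n) hσ
  set e : ℝ := (n : ℝ) / σ with he
  have he0 : 0 ≤ e := by positivity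
  have hg1 : (1 / 2 : ℝ) ^ α < 1 := Real.rpow_lt_one (by norm_num) (by norm_num) hα
  set c1 : ℝ := 2 * 2 ^ (α + e) * c * 2 ^ e / (1 - (1 / 2) ^ α) with hc1
  have hc1' : 0 < c1 := by
    have : 0 < 1 - (1 / 2 : ℝ) ^ α := by linarith
    positivity
  refine ⟨c + c1, by positivity, fun u F N x z δ ρ hN hF hF0 hxN hδ hsub hpair => ?_⟩
  set L := locNorm σ F z ρ with hL
  have hL0 : 0 ≤ L := locNorm_nonneg _ _ _ _
  set d : ℕ → ℝ := fun k => δ * (1 / 2) ^ k with hd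
  have hd0 : ∀ k, 0 < d k := fun k => by positivity
  have hdle : ∀ k, d k ≤ δ := fun k =>
    mul_le_of_le_one_right hδ.le (pow_le_one₀ (by norm_num) (by norm_num))
  have hdsucc : ∀ k, d k = 2 * d (k + 1) := fun k => by simp only [hd, pow_succ]; ring
  -- Select points near `x` at dyadic scales where `F` is at most its mean. Consecutive increments
  -- are then of size `d k ^ (α + e) * d k ^ (-e) = d k ^ α`, a convergent geometric series.
  have hex : ∀ k, ∃ x' ∈ Metric.ball x (d k), x' ∉ N ∧ F x' ≤ c * d k ^ (-e) * L := by
    intro k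
    obtain ⟨x', h1, h2, h3⟩ := hav F z ρ hF N hN x (d k) (hd0 k) (by linarith [hdle k])
    exact ⟨x', h1, h2, (le_abs_self _).trans h3⟩
  choose X hXb hXN hXF using hex
  have hXδ : ∀ k, X k ∈ Metric.ball x δ \ N := fun k =>
    ⟨Metric.ball_subset_ball (hdle k) (hXb k), hXN k⟩
  have hpow : ∀ k, d k ^ α = δ ^ α * ((1 / 2) ^ α) ^ k := by
    intro k
    simp only [hd]
    rw [Real.mul_rpow hδ.le (by positivity), ← Real.rpow_natCast, ← Real.rpow_natCast,
      ← Real.rpow_mul (by norm_num), ← Real.rpow_mul (by norm_num), mul_comm (k : ℝ)]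
  have hsplit : ∀ k, d k ^ (α + e) * d k ^ (-e) = d k ^ α := fun k => by
    rw [← Real.rpow_add (hd0 k)]; congr 1; ring
  have hstep : ∀ k, dist (u (X k)) (u (X (k + 1))) ≤
      (2 * 2 ^ (α + e) * c * 2 ^ e * δ ^ α * L) * ((1 / 2) ^ α) ^ k := by
    intro k
    rw [Real.dist_eq]
    have h1 := hpair _ (hXδ k) _ (hXδ (k + 1))
    have h2 : dist (X k) (X (k + 1)) ≤ 2 * d k := by
      have h3 := hXb k
      have h4 := hXb (k + 1)
      rw [Metric.mem_ball] at h3 h4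
      have h5 := dist_triangle_right (X k) (X (k + 1)) x
      have := hdsucc k
      have := hd0 (k + 1)
      linarith
    have h6 : d (k + 1) ^ (-e) = 2 ^ e * d k ^ (-e) := by
      rw [hdsucc k, Real.mul_rpow (by norm_num) (hd0 _).le, ← mul_assoc,
        ← Real.rpow_add (by norm_num)]
      simp
    have h7 : d k ^ (-e) ≤ 2 ^ e * d k ^ (-e) :=
      le_mul_of_one_le_left (by have := hd0 k; positivity) (Real.one_le_rpow (by norm_num) he0)
    calc _ ≤ (2 * d k) ^ (α + e) * (c * (2 ^ e * d k ^ (-e)) * L + c * (2 ^ e * d k ^ (-e)) * L) := by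
          refine h1.trans ?_
          have := hXF k
          have h8 := hXF (k + 1)
          rw [h6] at h8
          have := hF0 (X k)
          have := hF0 (X (k + 1))
          gcongr
          exact (hXF k).trans (by gcongr)
      _ = 2 * 2 ^ (α + e) * c * 2 ^ e * (d k ^ (α + e) * d k ^ (-e)) * L := by
          rw [Real.mul_rpow (by norm_num) (hd0 k).le]; ring
      _ = _ := by rw [hsplit, hpow]; ring
  have hlim0 : Filter.Tendsto d Filter.atTop (nhds 0) := by
    have := (tendsto_pow_atTop_nhds_zero_of_lt_one (r := (1 / 2 : ℝ)) (by norm_num)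
      (by norm_num)).const_mul δ
    simpa only [mul_zero] using this
  -- The uncontrolled value `F x` enters only with the vanishing factor `d k ^ (α + e)`, so it is
  -- absent from the final estimate.
  have hlim : Filter.Tendsto (fun k => u (X k)) Filter.atTop (nhds (u x)) := by
    rw [tendsto_iff_dist_tendsto_zero]
    have hz : Filter.Tendsto (fun k => d k ^ (α + e) * F x + c * L * d k ^ α) Filter.atTop
        (nhds 0) := by
      have ha := (hlim0.rpow_const (p := α) (Or.inr hα.le)).const_mul (c * L)
      have hb := (hlim0.rpow_const (p := α + e) (Or.inr (by positivity))).mul_const (F x)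
      rw [Real.zero_rpow (by positivity)] at ha hb
      simpa using hb.add ha
    refine squeeze_zero (fun _ => dist_nonneg) (fun k => ?_) hz
    rw [Real.dist_eq]
    have h1 := hpair _ (hXδ k) x ⟨Metric.mem_ball_self hδ, hxN⟩
    calc _ ≤ d k ^ (α + e) * (c * d k ^ (-e) * L + F x) := by
          refine h1.trans ?_
          have := hF0 (X k)
          have := hF0 x
          have h2 : dist (X k) x ^ (α + e) ≤ d k ^ (α + e) :=
            Real.rpow_le_rpow dist_nonneg (Metric.mem_ball.1 (hXb k)).le (by positivity)
          exact mul_le_mul h2 (by linarith [hXF k]) (by linarith)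
            (Real.rpow_nonneg (hd0 k).le _)
      _ = d k ^ (α + e) * F x + c * L * (d k ^ (α + e) * d k ^ (-e)) := by ring
      _ = _ := by rw [hsplit]
  have hsum := dist_le_of_le_geometric_of_tendsto₀ _ _ hg1 hstep hlim
  have hd00 : d 0 = δ := by simp [hd]
  refine ⟨X 0, (hXδ 0).1, hXN 0, ?_, ?_⟩
  · have := hXF 0
    rw [hd00] at this
    refine this.trans ?_
    gcongr
    linarith
  · rw [abs_sub_comm, ← Real.dist_eq]
    refine hsum.trans ?_
    calc _ = c1 * δ ^ α * L := by rw [hc1]; ring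
      _ ≤ _ := by gcongr; linarith

/-- Morrey's inequality for pairs of points that are close compared to their distance to the
boundary. -/
theorem exists_interior_morrey {σ α : ℝ} (hσ : 0 < σ) (hα : 0 < α) :
    ∃ C : ℝ, 0 < C ∧ ∀ (Ω N : Set (E n)) (u F : E n → ℝ), IsOpen Ω → volume N = 0 →
      (∀ z ρ, MemLp F (ENNReal.ofReal σ) (volume.restrict (Metric.ball z ρ))) → (∀ y, 0 ≤ F y) →
      IsBallGrad (α + n / σ) Ω N u F →
      ∀ x ∈ Ω \ N, ∀ y ∈ Ω \ N, edist x y < 2⁻¹ * Metric.infEDist x (frontier Ω) →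
        |u x - u y| ≤ C * dist x y ^ α * locNorm σ F x (2 * dist x y) := by
  obtain ⟨c, hc, hav⟩ := exists_mem_ball_abs_le (n := n) hσ
  obtain ⟨c', hc', hch⟩ := exists_chain_estimate (n := n) hσ hα
  set e : ℝ := (n : ℝ) / σ with he
  have he0 : 0 ≤ e := by positivity
  refine ⟨2 * c' + 2 * 10 ^ (α + e) * (c + c'), by positivity,
    fun Ω N u F hΩ hN hF hF0 hg x hx y hy hxy => ?_⟩
  rcases eq_or_ne x y with rfl | hne
  · simp [Real.zero_rpow hα.ne']
  set δ := dist x y / 16 with hδ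
  have hD : dist x y = 16 * δ := by rw [hδ]; ring
  have hδ0 : 0 < δ := by have := dist_pos.2 hne; positivity
  have hsubΩ : Metric.ball x (2 * dist x y) ⊆ Ω :=
    ball_subset_of_le_infEDist_frontier hΩ hx.1 (ofReal_two_mul_dist_lt hxy).le
  set ρ := 2 * dist x y with hρ
  set L := locNorm σ F x ρ with hL
  have hL0 : 0 ≤ L := locNorm_nonneg _ _ _ _
  have hpq : ∀ p q, dist x p < ρ → dist x q < ρ → p ∉ N → q ∉ N →
      2 * dist p q + dist x p ≤ 32 * δ → |u p - u q| ≤ dist p q ^ (α + e) * (F p + F q) := by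
    intro p q hp hq hpN hqN h
    refine hg p ⟨hsubΩ (by rwa [Metric.mem_ball']), hpN⟩ q ⟨hsubΩ (by rwa [Metric.mem_ball']), hqN⟩
      (edist_lt_of_close hxy ?_)
    linarith
  obtain ⟨x', hx'b, hx'N, hx'F, hx'u⟩ := hch u F N x x δ ρ hN (hF _ _) hF0 hx.2 hδ0
    (by rw [dist_self]; linarith) (by
      rintro p ⟨hp, hpN⟩ q ⟨hq, hqN⟩
      rw [Metric.mem_ball'] at hp hq
      have := dist_triangle_left p q x
      exact hpq p q (by linarith) (by linarith) hpN hqN (by linarith))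
  obtain ⟨y', hy'b, hy'N, hy'F, hy'u⟩ := hch u F N y x δ ρ hN (hF _ _) hF0 hy.2 hδ0
    (by rw [dist_comm]; linarith) (by
      rintro p ⟨hp, hpN⟩ q ⟨hq, hqN⟩
      rw [Metric.mem_ball'] at hp hq
      have := dist_triangle_left p q y
      have := dist_triangle x y p
      have := dist_triangle x y q
      exact hpq p q (by linarith) (by linarith) hpN hqN (by linarith))
  -- The points `x'` and `y'` may be too far apart for `hpq`, so they are joined through a good
  -- point `z` near the midpoint; each half-step has length at most `10 * δ`, which is admissible
  -- with `δ = dist x y / 16`.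
  have hmx : dist x (midpoint ℝ x y) = 8 * δ := by
    rw [dist_left_midpoint, hD]; norm_num; ring
  have hmy : dist (midpoint ℝ x y) y = 8 * δ := by
    rw [dist_midpoint_right, hD]; norm_num; ring
  obtain ⟨z, hzb, hzN, hzF⟩ := hav F x ρ (hF _ _) N hN (midpoint ℝ x y) δ hδ0
    (by rw [dist_comm, hmx]; linarith)
  have hzF' := (le_abs_self _).trans hzF
  rw [Metric.mem_ball'] at hx'b hy'b hzb
  have hxz : dist x z ≤ 9 * δ := by
    have := dist_triangle x (midpoint ℝ x y) z; linarith
  have hzy : dist z y ≤ 9 * δ := by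
    have := dist_triangle z (midpoint ℝ x y) y
    rw [dist_comm z (midpoint ℝ x y)] at this; linarith
  have hx'z : dist x' z ≤ 10 * δ := by
    have := dist_triangle x' x z
    rw [dist_comm x' x] at this; linarith
  have hzy' : dist z y' ≤ 10 * δ := by
    have := dist_triangle z y y'; linarith
  have hxy' : dist x y' ≤ 17 * δ := by
    have := dist_triangle x y y'; linarith
  have h1 := hpq x' z (by linarith) (by linarith) hx'N hzN (by linarith)
  have h2 := hpq z y' (by linarith) (by linarith) hzN hy'N (by linarith)
  have hmid : ∀ p q, dist p q ≤ 10 * δ → F p + F q ≤ (c + c') * δ ^ (-e) * L →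
      |u p - u q| ≤ dist p q ^ (α + e) * (F p + F q) →
      |u p - u q| ≤ 10 ^ (α + e) * (c + c') * δ ^ α * L := by
    intro p q hd hFpq hu
    have := hF0 p
    have := hF0 q
    calc _ ≤ (10 * δ) ^ (α + e) * ((c + c') * δ ^ (-e) * L) := by
          refine hu.trans ?_
          gcongr
      _ = 10 ^ (α + e) * (c + c') * (δ ^ (α + e) * δ ^ (-e)) * L := by
          rw [Real.mul_rpow (by norm_num) hδ0.le]; ring
      _ = _ := by rw [← Real.rpow_add hδ0]; ring_nf
  have h3 := hmid x' z hx'z (by linarith) h1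
  have h4 := hmid z y' hzy' (by linarith) h2
  have htri : |u x - u y| ≤ |u x - u x'| + |u x' - u z| + |u z - u y'| + |u y - u y'| := by
    rw [abs_sub_comm (u y)]
    have h5 := abs_sub_le (u x) (u x') (u y)
    have h6 := abs_sub_le (u x') (u z) (u y)
    have h7 := abs_sub_le (u z) (u y') (u y)
    linarith
  calc _ ≤ (2 * c' + 2 * 10 ^ (α + e) * (c + c')) * δ ^ α * L := by linarith
    _ ≤ _ := by
      gcongr
      rw [hD]; linarith

/-! ### Cutoffs of truncations as test functions. -/

theorem eLpNorm_indicator_ball {p : ℝ} (hp : 0 < p) {c : ℝ} (hc : 0 ≤ c) (x : E n) {ρ : ℝ}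
    (hρ : 0 < ρ) :
    eLpNorm ((Metric.ball x ρ).indicator fun _ => c) (ENNReal.ofReal p) volume =
      ENNReal.ofReal (c * ((volume (Metric.ball (0 : E n) 1)).toReal ^ (1 / p) *
        ρ ^ ((n : ℝ) / p))) := by
  rw [eLpNorm_indicator_const measurableSet_ball (by simpa using hp) ENNReal.ofReal_ne_top,
    ENNReal.toReal_ofReal hp.le, Real.enorm_eq_ofReal hc, volume_ball_eq x hρ,
    ENNReal.ofReal_mul hc]
  congr 1
  have hV := volume_unitBall_ne_top (n := n)
  rw [← ENNReal.ofReal_toReal hV, ← ENNReal.ofReal_mul (by positivity),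
    ENNReal.ofReal_rpow_of_nonneg (by positivity) (by positivity),
    Real.mul_rpow (by positivity) (by positivity), ← Real.rpow_natCast, ← Real.rpow_mul hρ.le,
    mul_one_div, mul_comm, ENNReal.toReal_ofReal (by positivity)]

/-- A cutoff function that is `1` on the ball of radius `ρ / 2` and `0` off the ball of
radius `ρ`. -/
def bump (x₀ : E n) (ρ : ℝ) (x : E n) : ℝ := max 0 (min 1 (2 - 2 / ρ * dist x x₀))

theorem bump_nonneg (x₀ : E n) (ρ : ℝ) (x : E n) : 0 ≤ bump x₀ ρ x := le_max_left _ _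

theorem bump_le_one (x₀ : E n) (ρ : ℝ) (x : E n) : bump x₀ ρ x ≤ 1 :=
  max_le zero_le_one (min_le_left _ _)

theorem bump_eq_zero {x₀ : E n} {ρ : ℝ} (hρ : 0 < ρ) {x : E n} (h : ρ ≤ dist x x₀) :
    bump x₀ ρ x = 0 := by
  apply max_eq_left
  refine (min_le_right _ _).trans ?_
  have : 2 / ρ * ρ ≤ 2 / ρ * dist x x₀ := by gcongr
  rw [div_mul_cancel₀ _ hρ.ne'] at this
  linarith

theorem bump_eq_one {x₀ : E n} {ρ : ℝ} (hρ : 0 < ρ) {x : E n} (h : dist x x₀ ≤ ρ / 2) :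
    bump x₀ ρ x = 1 := by
  have : 2 / ρ * dist x x₀ ≤ 2 / ρ * (ρ / 2) := by gcongr
  have h2 : 2 / ρ * (ρ / 2) = 1 := by field_simp
  rw [bump, min_eq_left (by linarith), max_eq_right zero_le_one]

theorem abs_clamp_sub_clamp_le (a b : ℝ) :
    |max 0 (min 1 a) - max 0 (min 1 b)| ≤ |a - b| := by
  rw [max_comm 0, max_comm 0, min_comm 1, min_comm 1]
  exact (abs_max_sub_max_le_abs _ _ _).trans
    ((abs_min_sub_min_le_max _ _ _ _).trans (by simp))

theorem abs_bump_sub_bump_le (x₀ : E n) {ρ : ℝ} (hρ : 0 < ρ) (x y : E n) :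
    |bump x₀ ρ x - bump x₀ ρ y| ≤ 2 / ρ * dist x y := by
  refine (abs_clamp_sub_clamp_le _ _).trans ?_
  have : 2 - 2 / ρ * dist x x₀ - (2 - 2 / ρ * dist y x₀) = 2 / ρ * (dist y x₀ - dist x x₀) := by
    ring
  rw [this, abs_mul, abs_of_pos (by positivity), dist_comm x y]
  gcongr
  exact abs_dist_sub_le _ _ _

theorem continuous_bump (x₀ : E n) (ρ : ℝ) : Continuous (bump x₀ ρ) := by
  unfold bump
  fun_prop

theorem add_rpow_le_of_le_one {a b θ : ℝ} (ha : 0 ≤ a) (hb : 0 ≤ b) (hθ : 0 ≤ θ) (hθ1 : θ ≤ 1) :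
    (a + b) ^ θ ≤ a ^ θ + b ^ θ := by
  lift a to ℝ≥0 using ha
  lift b to ℝ≥0 using hb
  exact_mod_cast NNReal.rpow_add_le_add_rpow a b hθ hθ1

/-- Interpolation between a Hajłasz inequality of order `α + e` and a Hölder inequality of
order `α`. -/
theorem le_rpow_mul_of_interpolation {X D a b H α e θ : ℝ} (hX : 0 ≤ X) (hD : 0 ≤ D) (ha : 0 ≤ a)
    (hb : 0 ≤ b) (hH : 0 ≤ H) (hα : 0 < α) (he : 0 ≤ e) (hθ : 0 ≤ θ) (hθ1 : θ ≤ 1)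
    (h1 : X ≤ D ^ (α + e) * (a + b)) (h2 : X ≤ D ^ α * H) :
    X ≤ D ^ (α + e * θ) * (a ^ θ * H ^ (1 - θ) + b ^ θ * H ^ (1 - θ)) := by
  have hθ' : 0 ≤ 1 - θ := by linarith
  calc X = X ^ θ * X ^ (1 - θ) := by
        rw [← Real.rpow_add' hX (by norm_num)]; simp
    _ ≤ (D ^ (α + e) * (a + b)) ^ θ * (D ^ α * H) ^ (1 - θ) := by gcongr
    _ = (D ^ ((α + e) * θ) * D ^ (α * (1 - θ))) * ((a + b) ^ θ * H ^ (1 - θ)) := by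
        rw [Real.mul_rpow (by positivity) (by positivity), Real.mul_rpow (by positivity) hH,
          ← Real.rpow_mul hD, ← Real.rpow_mul hD]
        ring
    _ = D ^ (α + e * θ) * ((a + b) ^ θ * H ^ (1 - θ)) := by
        rw [← Real.rpow_add' hD]
        · congr 2; ring
        · have : (α + e) * θ + α * (1 - θ) = α + e * θ := by ring
          rw [this]; positivity
    _ ≤ D ^ (α + e * θ) * ((a ^ θ + b ^ θ) * H ^ (1 - θ)) := by
        gcongr
        exact add_rpow_le_of_le_one ha hb hθ hθ1
    _ = _ := by ring

/-- A cutoff of a truncation of `u` has a gradient of order `s` in `L^p`. -/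
theorem exists_gradient_bump_mul {s p σ : ℝ} (hs : 0 < s) (hs1 : s ≤ 1) (hp1 : 1 ≤ p)
    (hα : 0 < s - n / p) (hσ : 0 < σ) (hσp : σ ≤ p) :
    ∃ C : ℝ, 0 < C ∧ ∀ (Ω N : Set (E n)) (u F w : E n → ℝ), IsOpen Ω → volume N = 0 →
      Measurable F →
      (∀ z ρ, MemLp F (ENNReal.ofReal σ) (volume.restrict (Metric.ball z ρ))) → (∀ y, 0 ≤ F y) →
      IsBallGrad (s - n / p + n / σ) Ω N u F → ∀ A : ℝ, 0 < A → (∀ x, 0 ≤ w x) → (∀ x, w x ≤ 1) →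
      (∀ x y, |w x - w y| ≤ |u x - u y| / A) → ∀ (x₀ : E n) (ρ : ℝ), 0 < ρ →
      ∃ h : E n → ℝ, Measurable h ∧ (∀ x, 0 ≤ h x) ∧
        IsBallGrad s Ω N (fun x => bump x₀ ρ x * w x) h ∧
        eLpNorm h (ENNReal.ofReal p) volume ≤
          ENNReal.ofReal (C * (ρ ^ (-(s - n / p)) + locNorm σ F x₀ (4 * ρ) / A)) := by
  have hp : 0 < p := by linarith
  set α := s - n / p with hαdef
  obtain ⟨c, hc, hmor⟩ := exists_interior_morrey (n := n) hσ hα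
  set V := (volume (Metric.ball (0 : E n) 1)).toReal with hV
  -- This value makes `α + (n / σ) * θ = s` and puts `F ^ θ` locally in `L^p` when `F` is locally in
  -- `L^σ`.
  set θ := σ / p with hθ
  have hθ0 : 0 < θ := by positivity
  have hθ1 : θ ≤ 1 := (div_le_one hp).2 hσp
  have hθ' : 0 ≤ 1 - θ := by linarith
  refine ⟨2 ^ s * (V ^ (1 / p) * 2 ^ ((n : ℝ) / p)) + c ^ (1 - θ) , by positivity, ?_⟩
  intro Ω N u F w hΩ hN hFm hF hF0 hg A hA hw0 hw1 hwu x₀ ρ hρ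
  set G := locNorm σ F x₀ (4 * ρ) with hG
  have hG0 : 0 ≤ G := locNorm_nonneg _ _ _ _
  set K := (c * G) ^ (1 - θ) / A with hK
  have hK0 : 0 ≤ K := by positivity
  set b := Metric.ball x₀ (2 * ρ) with hb
  -- `h₁` pays for the cutoff and `h₂` for the truncation. A pair at distance below `ρ / 2` with a
  -- point in the ball of radius `ρ` lies in `b`; for more distant pairs the bound by `1` suffices
  -- and `h₁` alone is enough.
  set h₁ : E n → ℝ := b.indicator fun _ => (2 / ρ) ^ s with hh₁
  set h₂ : E n → ℝ := b.indicator fun x => F x ^ θ * K with hh₂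
  have hh₁0 : ∀ x, 0 ≤ h₁ x := fun x => Set.indicator_nonneg (fun _ _ => by positivity) x
  have hh₂0 : ∀ x, 0 ≤ h₂ x := fun x =>
    Set.indicator_nonneg (fun y _ => by have := hF0 y; positivity) x
  have hh₁m : Measurable h₁ := measurable_const.indicator measurableSet_ball
  have hh₂m : Measurable h₂ := ((hFm.pow_const _).mul_const _).indicator measurableSet_ball
  refine ⟨h₁ + h₂, hh₁m.add hh₂m, fun x => add_nonneg (hh₁0 x) (hh₂0 x), ?_, ?_⟩
  · intro x hx y hy hxy
    set D := dist x y with hD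
    have hD0 : 0 ≤ D := dist_nonneg
    have hb0 := bump_nonneg x₀ ρ
    have hb1 := bump_le_one x₀ ρ
    have hv0 : ∀ x, 0 ≤ bump x₀ ρ x * w x := fun x => mul_nonneg (hb0 x) (hw0 x)
    have hv1 : ∀ x, bump x₀ ρ x * w x ≤ 1 := fun x => mul_le_one₀ (hb1 x) (hw0 x) (hw1 x)
    simp only [Pi.add_apply]
    by_cases hfar : ρ ≤ dist x x₀ ∧ ρ ≤ dist y x₀
    · simp only [bump_eq_zero hρ hfar.1, bump_eq_zero hρ hfar.2, zero_mul, sub_zero, abs_zero]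
      have := hh₁0 x
      have := hh₁0 y
      have := hh₂0 x
      have := hh₂0 y
      positivity
    have hsum1 : (2 / ρ) ^ s ≤ h₁ x + h₁ y := by
      rcases not_and_or.1 hfar with h | h
      · have : h₁ x = (2 / ρ) ^ s :=
          Set.indicator_of_mem (by rw [hb, Metric.mem_ball]; linarith) _
        linarith [hh₁0 y]
      · have : h₁ y = (2 / ρ) ^ s :=
          Set.indicator_of_mem (by rw [hb, Metric.mem_ball]; linarith) _
        linarith [hh₁0 x]
    have hfirst : (2 / ρ * D) ^ s ≤ D ^ s * (h₁ x + h₁ y) := by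
      rw [Real.mul_rpow (by positivity) hD0, mul_comm]
      gcongr
    have hsecond0 : 0 ≤ D ^ s * (h₂ x + h₂ y) := by
      have := hh₂0 x
      have := hh₂0 y
      positivity
    have hgoal : |bump x₀ ρ x * w x - bump x₀ ρ y * w y| ≤
        (2 / ρ * D) ^ s + D ^ s * (h₂ x + h₂ y) → |bump x₀ ρ x * w x - bump x₀ ρ y * w y| ≤
        D ^ s * (h₁ x + h₂ x + (h₁ y + h₂ y)) := fun h => by
      refine h.trans ?_
      calc _ ≤ D ^ s * (h₁ x + h₁ y) + D ^ s * (h₂ x + h₂ y) := by gcongr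
        _ = _ := by ring
    apply hgoal
    rcases le_or_gt 1 (2 / ρ * D) with hlarge | hsmall
    · have h1 : 1 ≤ (2 / ρ * D) ^ s := Real.one_le_rpow hlarge hs.le
      have h2 : |bump x₀ ρ x * w x - bump x₀ ρ y * w y| ≤ 1 := by
        rw [abs_le]
        constructor <;> linarith [hv0 x, hv0 y, hv1 x, hv1 y]
      linarith
    have hDρ : 2 * D < ρ := by
      have : 2 / ρ * D * ρ < 1 * ρ := by gcongr
      have h2 : 2 / ρ * D * ρ = 2 * D := by field_simp
      linarith
    have hxb : dist x x₀ < 2 * ρ ∧ dist y x₀ < 2 * ρ := by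
      have h1 := dist_triangle x y x₀
      have h2 := dist_triangle_left y x₀ x
      rcases not_and_or.1 hfar with h | h
      · constructor <;> linarith
      · constructor <;> linarith
    have hh₂x : h₂ x = F x ^ θ * K := Set.indicator_of_mem (by exact hxb.1) _
    have hh₂y : h₂ y = F y ^ θ * K := Set.indicator_of_mem (by exact hxb.2) _
    have hprod : |bump x₀ ρ x * w x - bump x₀ ρ y * w y| ≤
        |bump x₀ ρ x - bump x₀ ρ y| + |w x - w y| := by
      have : bump x₀ ρ x * w x - bump x₀ ρ y * w y =
          (bump x₀ ρ x - bump x₀ ρ y) * w x + bump x₀ ρ y * (w x - w y) := by ring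
      rw [this]
      refine (abs_add_le _ _).trans ?_
      rw [abs_mul, abs_mul, abs_of_nonneg (hw0 x), abs_of_nonneg (hb0 y)]
      gcongr
      · exact mul_le_of_le_one_right (abs_nonneg _) (hw1 x)
      · exact mul_le_of_le_one_left (abs_nonneg _) (hb1 y)
    refine hprod.trans (add_le_add ?_ ?_)
    · refine (abs_bump_sub_bump_le x₀ hρ x y).trans ?_
      exact Real.self_le_rpow_of_le_one (by positivity) hsmall.le hs1
    · have hX1 := hg x hx y hy hxy
      have hX2 := hmor Ω N u F hΩ hN hF hF0 hg x hx y hy hxy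
      have hloc : locNorm σ F x (2 * D) ≤ G := locNorm_mono (hF _ _) (by linarith)
      have hX2' : |u x - u y| ≤ D ^ α * (c * G) := by
        refine hX2.trans ?_
        calc _ = D ^ α * (c * locNorm σ F x (2 * D)) := by ring
          _ ≤ _ := by gcongr
      have hint := le_rpow_mul_of_interpolation (abs_nonneg _) hD0 (hF0 x) (hF0 y)
        (by positivity) hα (by positivity) hθ0.le hθ1 hX1 hX2'
      have hexp : α + (n : ℝ) / σ * θ = s := by
        rw [hθ, hαdef]; field_simp; ring
      rw [hexp] at hint
      refine (hwu x y).trans ?_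
      rw [div_le_iff₀ hA, hh₂x, hh₂y, hK]
      refine hint.trans (le_of_eq ?_)
      field_simp
  · have hone : 1 ≤ ENNReal.ofReal p := by
      rw [← ENNReal.ofReal_one]; exact ENNReal.ofReal_le_ofReal hp1
    refine (eLpNorm_add_le hh₁m.aestronglyMeasurable hh₂m.aestronglyMeasurable hone).trans ?_
    have e1 : eLpNorm h₁ (ENNReal.ofReal p) volume ≤
        ENNReal.ofReal (2 ^ s * (V ^ (1 / p) * 2 ^ ((n : ℝ) / p)) * ρ ^ (-α)) := by
      rw [hh₁, hb, eLpNorm_indicator_ball hp (by positivity) x₀ (by positivity)]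
      apply ENNReal.ofReal_le_ofReal
      rw [Real.div_rpow (by norm_num) hρ.le, Real.mul_rpow (by norm_num) hρ.le]
      have : ρ ^ (-α) = ρ ^ ((n : ℝ) / p) / ρ ^ s := by
        rw [← Real.rpow_sub hρ]; congr 1; rw [hαdef]; ring
      rw [this]
      apply le_of_eq
      ring
    have e2 : eLpNorm h₂ (ENNReal.ofReal p) volume ≤ ENNReal.ofReal (c ^ (1 - θ) * (G / A)) := by
      have hind : eLpNorm h₂ (ENNReal.ofReal p) volume =
          eLpNorm (K • fun x => ‖F x‖ ^ θ) (ENNReal.ofReal p) (volume.restrict b) := by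
        rw [hh₂, eLpNorm_indicator_eq_eLpNorm_restrict measurableSet_ball]
        congr 1
        ext x
        simp only [Pi.smul_apply, smul_eq_mul, Real.norm_eq_abs, abs_of_nonneg (hF0 x)]
        ring
      rw [hind, eLpNorm_const_smul, eLpNorm_norm_rpow _ hθ0, ← ENNReal.ofReal_mul hp.le,
        show p * θ = σ by rw [hθ]; field_simp, Real.enorm_eq_ofReal hK0,
        ← ENNReal.ofReal_toReal (hF x₀ (2 * ρ)).eLpNorm_ne_top,
        ENNReal.ofReal_rpow_of_nonneg ENNReal.toReal_nonneg hθ0.le, ← ENNReal.ofReal_mul hK0]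
      apply ENNReal.ofReal_le_ofReal
      have hle : locNorm σ F x₀ (2 * ρ) ≤ G :=
        locNorm_mono (hF _ _) (by rw [dist_self]; linarith)
      -- The powers `1 - θ` and `θ` of `G` recombine, so the bound is linear in `G / A`; this
      -- linearity permits solving for `A` later.
      calc K * locNorm σ F x₀ (2 * ρ) ^ θ ≤ K * G ^ θ := by
            gcongr
            exact locNorm_nonneg _ _ _ _
        _ = c ^ (1 - θ) * (G ^ (1 - θ) * G ^ θ / A) := by
            rw [hK, Real.mul_rpow hc.le hG0]; ring
        _ = _ := by
            rw [← Real.rpow_add' hG0 (by norm_num)]; simp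
    refine (add_le_add e1 e2).trans ?_
    rw [← ENNReal.ofReal_add (by positivity) (by positivity)]
    apply ENNReal.ofReal_le_ofReal
    have q1 : 0 ≤ 2 ^ s * (V ^ (1 / p) * 2 ^ ((n : ℝ) / p)) := by positivity
    have q2 : 0 ≤ c ^ (1 - θ) := by positivity
    have q3 : 0 ≤ ρ ^ (-α) := by positivity
    have q4 : 0 ≤ G / A := by positivity
    nlinarith [mul_nonneg q1 q4, mul_nonneg q2 q3]

/-! ### Testing the imbedding: Morrey's inequality in the domain. -/

/-- Functions of small homogeneous Hölder norm satisfy the Hölder inequality off a null set. -/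
theorem exists_null_of_homNorm_lt {α M : ℝ} {Ω : Set (E n)} (hΩ : MeasurableSet Ω) {v : E n → ℝ}
    (h : homNorm α ∞ Ω v < ENNReal.ofReal M) :
    ∃ N : Set (E n), volume N = 0 ∧ ∀ x ∈ Ω \ N, ∀ y ∈ Ω \ N,
      |v x - v y| ≤ dist x y ^ α * (2 * M) := by
  simp only [homNorm, iInf_lt_iff] at h
  obtain ⟨g, ⟨-, -, N, hN, hg⟩, hlt⟩ := h
  rw [eLpNorm_exponent_top] at hlt
  have hae := ae_lt_of_essSup_lt (by simpa [eLpNormEssSup] using hlt)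
  rw [ae_restrict_iff' hΩ, ae_iff] at hae
  set N' := {x | ¬(x ∈ Ω → ‖g x‖ₑ < ENNReal.ofReal M)} with hN'
  have hgM : ∀ x ∈ Ω, x ∉ N' → g x ≤ M := by
    intro x hx hxN
    have h1 : ‖g x‖ₑ < ENNReal.ofReal M := not_not.1 hxN hx
    rw [← ofReal_norm] at h1
    exact (Real.le_norm_self _).trans (ENNReal.ofReal_lt_ofReal_iff_of_nonneg (norm_nonneg _)
      |>.1 h1).le
  refine ⟨N ∪ N', measure_union_null hN hae, fun x hx y hy => ?_⟩
  simp only [Set.mem_sdiff, Set.mem_union, not_or] at hx hy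
  refine (hg x ⟨hx.1, hx.2.1⟩ y ⟨hy.1, hy.2.1⟩).trans ?_
  gcongr
  linarith [hgM x hx.1 hx.2.2, hgM y hy.1 hy.2.2]

theorem exists_mem_ball_notMem {N : Set (E n)} (hN : volume N = 0) (x : E n) {δ : ℝ} (hδ : 0 < δ) :
    ∃ y ∈ Metric.ball x δ, y ∉ N := by
  by_contra! h
  exact (Metric.measure_ball_pos volume x hδ).ne' (measure_mono_null h hN)

theorem infEDist_frontier_pos {Ω : Set (E n)} (hΩ : IsOpen Ω) {x : E n} (hx : x ∈ Ω) :
    0 < Metric.infEDist x (frontier Ω) := by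
  rw [pos_iff_ne_zero, Ne, ← Metric.mem_iff_infEDist_zero_of_closed isClosed_frontier,
    hΩ.frontier_eq]
  exact fun h => h.2 hx

/-- Off the exceptional set, a function with a gradient of ball type is continuous. -/
theorem exists_ball_abs_sub_le {σ α : ℝ} (hσ : 0 < σ) (hα : 0 < α) {Ω N : Set (E n)}
    {u F : E n → ℝ} (hΩ : IsOpen Ω) (hN : volume N = 0)
    (hF : ∀ z ρ, MemLp F (ENNReal.ofReal σ) (volume.restrict (Metric.ball z ρ)))
    (hF0 : ∀ y, 0 ≤ F y) (hg : IsBallGrad (α + n / σ) Ω N u F) {x : E n} (hx : x ∈ Ω \ N) {ε : ℝ}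
    (hε : 0 < ε) :
    ∃ δ : ℝ, 0 < δ ∧ ∀ y ∈ Metric.ball x δ, y ∈ Ω ∧ (y ∉ N → |u x - u y| ≤ ε) := by
  obtain ⟨C, hC, hmor⟩ := exists_interior_morrey (n := n) hσ hα
  set L := locNorm σ F x 2 with hL
  have hL0 : 0 ≤ L := locNorm_nonneg _ _ _ _
  obtain ⟨δ₁, hδ₁, h₁⟩ : ∃ δ₁ : ℝ, 0 < δ₁ ∧
      ENNReal.ofReal δ₁ < 2⁻¹ * Metric.infEDist x (frontier Ω) := by
    have hpos : 0 < 2⁻¹ * Metric.infEDist x (frontier Ω) :=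
      ENNReal.mul_pos (by simp) (infEDist_frontier_pos hΩ hx.1).ne'
    obtain ⟨c, hc, hc'⟩ := ENNReal.lt_iff_exists_real_btwn.1 hpos
    refine ⟨c, ?_, hc'.2⟩
    simpa using hc'.1
  set δ₂ := (ε / (C * L + 1)) ^ (1 / α) with hδ₂
  have hδ₂0 : 0 < δ₂ := by positivity
  have hδ₂α : δ₂ ^ α = ε / (C * L + 1) := by
    rw [hδ₂, ← Real.rpow_mul (by positivity), one_div_mul_cancel hα.ne', Real.rpow_one]
  refine ⟨min δ₁ (min δ₂ 1), by positivity, fun y hy => ?_⟩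
  rw [Metric.mem_ball', lt_min_iff, lt_min_iff] at hy
  obtain ⟨hy1, hy2, hy3⟩ := hy
  have hyΩ : y ∈ Ω := by
    refine ball_subset_of_le_infEDist_frontier hΩ hx.1 (h₁.le.trans ?_)
      (Metric.mem_ball'.2 hy1)
    exact mul_le_of_le_one_left' (by simp)
  refine ⟨hyΩ, fun hyN => ?_⟩
  have hxy : edist x y < 2⁻¹ * Metric.infEDist x (frontier Ω) := by
    rw [edist_dist]
    exact (ENNReal.ofReal_le_ofReal hy1.le).trans_lt h₁
  refine (hmor Ω N u F hΩ hN hF hF0 hg x hx y ⟨hyΩ, hyN⟩ hxy).trans ?_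
  calc _ ≤ C * δ₂ ^ α * L := by
        gcongr
        · exact locNorm_nonneg _ _ _ _
        · exact locNorm_mono (hF _ _) (by rw [dist_self]; linarith)
    _ = ε * (C * L / (C * L + 1)) := by rw [hδ₂α]; ring
    _ ≤ ε := mul_le_of_le_one_right hε.le
        (div_le_one_of_le₀ (by linarith) (by positivity))

/-- The imbedding inequality for bounded functions supported in balls whose radius satisfies
`P`. -/
def TestImbedding (s p : ℝ) (P : ℝ → Prop) (K : ℝ) (Ω : Set (E n)) : Prop :=
  ∀ ρ : ℝ, 0 < ρ → P ρ → ∀ (x₀ : E n) (v h : E n → ℝ) (N : Set (E n)), volume N = 0 →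
    AEStronglyMeasurable v (volume.restrict Ω) → (∀ x, |v x| ≤ 1) →
    (∀ x, ρ ≤ dist x x₀ → v x = 0) → Measurable h → (∀ x, 0 ≤ h x) → IsBallGrad s Ω N v h →
    homNorm (s - n / p) ∞ Ω v ≤
      ENNReal.ofReal K * (eLpNorm h (ENNReal.ofReal p) volume +
        ENNReal.ofReal (ρ ^ (-(s - n / p))))

theorem homBallNorm_le {s : ℝ} {p : ℝ≥0∞} {Ω N : Set (E n)} {v h : E n → ℝ} (hN : volume N = 0)
    (hh : Measurable h) (hh0 : ∀ x, 0 ≤ h x) (hg : IsBallGrad s Ω N v h) :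
    homBallNorm s p Ω v ≤ eLpNorm h p volume := by
  have hmem : h ∈ ballGrads s Ω v := ⟨hh.aestronglyMeasurable, fun x _ => hh0 x, N, hN, hg⟩
  exact (iInf₂_le h hmem).trans (eLpNorm_mono_measure _ Measure.restrict_le_self)

/-- The homogeneous norm ignores the size of the test function, so every radius is allowed and the
term in `ρ` is slack. -/
theorem IsHomBallImbeddingDomain.exists_testImbedding {s p : ℝ} {Ω : Set (E n)}
    (h : IsHomBallImbeddingDomain s p Ω) :
    ∃ K : ℝ, 0 < K ∧ TestImbedding s p (fun _ => True) K Ω := by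
  obtain ⟨-, C, hC, hle⟩ := h
  refine ⟨C, hC, fun ρ hρ _ x₀ v h N hN hv _ _ hh hh0 hg => ?_⟩
  have h1 := homBallNorm_le (p := ENNReal.ofReal p) hN hh hh0 hg
  rw [ENNReal.ofReal_coe_nnreal]
  by_cases htop : eLpNorm h (ENNReal.ofReal p) volume = ∞
  · rw [htop, top_add, ENNReal.mul_top (by exact_mod_cast hC.ne')]
    exact le_top
  refine (hle v ⟨hv, h1.trans_lt (lt_top_iff_ne_top.2 htop)⟩).trans ?_
  gcongr
  exact h1.trans le_self_add

theorem eLpNorm_le_of_support_ball {p : ℝ} (hp : 0 < p) {v : E n → ℝ} {x₀ : E n} {ρ : ℝ}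
    (hρ : 0 < ρ) (hv1 : ∀ x, |v x| ≤ 1) (hv0 : ∀ x, ρ ≤ dist x x₀ → v x = 0) :
    eLpNorm v (ENNReal.ofReal p) volume ≤
      ENNReal.ofReal ((volume (Metric.ball (0 : E n) 1)).toReal ^ (1 / p) *
        ρ ^ ((n : ℝ) / p)) := by
  have h := eLpNorm_indicator_ball hp zero_le_one x₀ hρ
  rw [one_mul] at h
  rw [← h]
  refine eLpNorm_mono_real fun x => ?_
  rw [Real.norm_eq_abs]
  by_cases hx : x ∈ Metric.ball x₀ ρ
  · rw [Set.indicator_of_mem hx]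
    exact hv1 x
  · rw [Set.indicator_of_notMem hx, hv0 x (not_lt.1 hx), abs_zero]

theorem IsInhomBallImbeddingDomain.inhomNorm_le {s p : ℝ} {Ω : Set (E n)}
    (h : IsInhomBallImbeddingDomain s p Ω) :
    ∃ K : ℝ, 0 < K ∧ ∀ (v h : E n → ℝ) (N : Set (E n)), volume N = 0 →
      AEStronglyMeasurable v (volume.restrict Ω) → Measurable h → (∀ x, 0 ≤ h x) →
      IsBallGrad s Ω N v h →
      inhomNorm (s - n / p) ∞ Ω v ≤ ENNReal.ofReal K *
        (eLpNorm h (ENNReal.ofReal p) volume +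
          eLpNorm v (ENNReal.ofReal p) (volume.restrict Ω)) := by
  obtain ⟨-, C, hC, hle⟩ := h
  refine ⟨C, hC, fun v h N hN hv hh hh0 hg => ?_⟩
  have h1 := homBallNorm_le (p := ENNReal.ofReal p) hN hh hh0 hg
  have h2 : inhomBallNorm s (ENNReal.ofReal p) Ω v ≤ eLpNorm h (ENNReal.ofReal p) volume +
      eLpNorm v (ENNReal.ofReal p) (volume.restrict Ω) := by
    unfold inhomBallNorm
    gcongr
  rw [ENNReal.ofReal_coe_nnreal]
  by_cases htop : eLpNorm h (ENNReal.ofReal p) volume +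
      eLpNorm v (ENNReal.ofReal p) (volume.restrict Ω) = ∞
  · rw [htop, ENNReal.mul_top (by exact_mod_cast hC.ne')]
    exact le_top
  refine (hle v ⟨hv, h2.trans_lt (lt_top_iff_ne_top.2 htop)⟩).trans ?_
  gcongr

/-- The extra `L^p` norm of the test function is at most a constant times `ρ ^ (n / p)`, which is
below `ρ ^ (-(s - n / p))` when `ρ ≤ 1`. This is the source of the restriction on the radius. -/
theorem IsInhomBallImbeddingDomain.exists_testImbedding {s p : ℝ} (hs : 0 < s) (hp : 0 < p)
    {Ω : Set (E n)} (h : IsInhomBallImbeddingDomain s p Ω) :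
    ∃ K : ℝ, 0 < K ∧ TestImbedding s p (fun ρ => ρ ≤ 1) K Ω := by
  obtain ⟨C, hC, hle⟩ := h.inhomNorm_le
  set V := (volume (Metric.ball (0 : E n) 1)).toReal ^ (1 / p) with hV
  have hV0 : 0 ≤ V := by positivity
  refine ⟨C * (1 + V), by positivity, fun ρ hρ hρ1 x₀ v h N hN hv hv1 hv0 hh hh0 hg => ?_⟩
  have h1 : eLpNorm v (ENNReal.ofReal p) (volume.restrict Ω) ≤
      ENNReal.ofReal (1 + V) * ENNReal.ofReal (ρ ^ (-(s - n / p))) := by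
    refine (eLpNorm_mono_measure _ Measure.restrict_le_self).trans
      ((eLpNorm_le_of_support_ball hp hρ hv1 hv0).trans ?_)
    rw [← ENNReal.ofReal_mul (by positivity)]
    apply ENNReal.ofReal_le_ofReal
    gcongr ?_ * ?_
    · linarith
    · exact Real.rpow_le_rpow_of_exponent_ge hρ hρ1 (by linarith)
  calc homNorm (s - n / p) ∞ Ω v ≤ inhomNorm (s - n / p) ∞ Ω v := le_self_add
    _ ≤ _ := hle v h N hN hv hh hh0 hg
    _ ≤ ENNReal.ofReal C * (ENNReal.ofReal (1 + V) * eLpNorm h (ENNReal.ofReal p) volume +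
        ENNReal.ofReal (1 + V) * ENNReal.ofReal (ρ ^ (-(s - n / p)))) := by
        gcongr
        refine le_mul_of_one_le_left' ?_
        rw [← ENNReal.ofReal_one]
        exact ENNReal.ofReal_le_ofReal (by linarith)
    _ = _ := by
        rw [ENNReal.ofReal_mul hC.le]
        ring

/-- The imbedding localizes to balls whose radius is comparable to the distance of the points. -/
theorem TestImbedding.exists_local_morrey {s p σ K : ℝ} {P : ℝ → Prop} {Ω : Set (E n)}
    (hT : TestImbedding s p P K Ω) (hK : 0 < K) (hΩ : IsOpen Ω) (hs : 0 < s) (hs1 : s ≤ 1)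
    (hp1 : 1 ≤ p) (hα : 0 < s - n / p) (hσ : 0 < σ) (hσp : σ ≤ p) :
    ∃ C R : ℝ, 0 < C ∧ 4 ≤ R ∧ ∀ (N : Set (E n)) (u F : E n → ℝ), volume N = 0 →
      AEStronglyMeasurable u (volume.restrict Ω) → Measurable F →
      (∀ z ρ, MemLp F (ENNReal.ofReal σ) (volume.restrict (Metric.ball z ρ))) → (∀ y, 0 ≤ F y) →
      IsBallGrad (s - n / p + n / σ) Ω N u F → ∀ x ∈ Ω \ N, ∀ y ∈ Ω \ N, P (R * dist x y) →
      |u x - u y| ≤ C * dist x y ^ (s - n / p) * locNorm σ F x (4 * (R * dist x y)) := by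
  obtain ⟨C₀, hC₀, htest⟩ := exists_gradient_bump_mul (n := n) hs hs1 hp1 hα hσ hσp
  set α := s - n / p with hαdef
  set C₁ := K * (C₀ + 1) with hC₁
  have hC₁0 : 0 < C₁ := by positivity
  set C₃ := 8 * 2 ^ α * C₁ with hC₃
  have hC₃0 : 0 < C₃ := by positivity
  -- The second entry makes the cutoff's contribution at most `1 / 2`, hence absorbable; `R ≥ 4`
  -- ensures that the cutoff equals `1` near both `x` and `y`.
  set R := max 4 ((2 * C₃) ^ (1 / α)) with hR
  have hR4 : 4 ≤ R := le_max_left _ _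
  have hRα : C₃ * R ^ (-α) ≤ 1 / 2 := by
    have h1 : 2 * C₃ ≤ R ^ α := by
      calc 2 * C₃ = ((2 * C₃) ^ (1 / α)) ^ α := by
            rw [← Real.rpow_mul (by positivity), one_div_mul_cancel hα.ne', Real.rpow_one]
        _ ≤ R ^ α := by
            gcongr
            exact le_max_right _ _
    rw [Real.rpow_neg (by linarith), ← div_eq_mul_inv, div_le_iff₀ (by positivity)]
    linarith
  refine ⟨2 * C₃, R, by positivity, hR4, fun N u F hN hu hFm hF hF0 hg x hx y hy hP => ?_⟩
  set r := dist x y with hr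
  set G := locNorm σ F x (4 * (R * r)) with hG
  have hG0 : 0 ≤ G := locNorm_nonneg _ _ _ _
  rcases eq_or_ne (u x) (u y) with heq | hne
  · rw [heq, sub_self, abs_zero]
    positivity
  have hxy : x ≠ y := fun h => hne (by rw [h])
  have hr0 : 0 < r := dist_pos.2 hxy
  set A := |u x - u y| with hA
  have hA0 : 0 < A := abs_pos.2 (sub_ne_zero.2 hne)
  have hd : u y - u x ≠ 0 := sub_ne_zero.2 hne.symm
  set w : E n → ℝ := fun z => max 0 (min 1 ((u z - u x) / (u y - u x))) with hw
  have hw0 : ∀ z, 0 ≤ w z := fun z => le_max_left _ _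
  have hw1 : ∀ z, w z ≤ 1 := fun z => max_le zero_le_one (min_le_left _ _)
  have hwu : ∀ z z', |w z - w z'| ≤ |u z - u z'| / A := fun z z' => by
    refine (abs_clamp_sub_clamp_le _ _).trans (le_of_eq ?_)
    rw [← sub_div, abs_div, hA, abs_sub_comm (u x)]
    congr 2
    ring
  set ρ := R * r with hρ
  have hρ0 : 0 < ρ := by positivity
  obtain ⟨h, hhm, hh0, hhg, hhn⟩ := htest Ω N u F w hΩ hN hFm hF hF0 hg A hA0 hw0 hw1 hwu x ρ hρ0
  set v : E n → ℝ := fun z => bump x ρ z * w z with hv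
  have hwm : AEStronglyMeasurable w (volume.restrict Ω) := by
    have : Continuous fun a : ℝ => max 0 (min 1 ((a - u x) / (u y - u x))) := by fun_prop
    exact this.comp_aestronglyMeasurable hu
  have hvm : AEStronglyMeasurable v (volume.restrict Ω) :=
    (continuous_bump x ρ).aestronglyMeasurable.mul hwm
  have hv1 : ∀ z, |v z| ≤ 1 := fun z => by
    rw [abs_of_nonneg (mul_nonneg (bump_nonneg _ _ _) (hw0 z))]
    exact mul_le_one₀ (bump_le_one _ _ _) (hw0 z) (hw1 z)
  have himb := hT ρ hρ0 hP x v h N hN hvm hv1 (fun z hz => by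
    rw [hv]; simp only; rw [bump_eq_zero hρ0 hz, zero_mul]) hhm hh0 hhg
  set M := C₁ * (ρ ^ (-α) + G / A) with hM
  have hM0 : 0 < M := by positivity
  have hnorm : homNorm α ∞ Ω v < ENNReal.ofReal (2 * M) := by
    refine lt_of_le_of_lt himb ?_
    have : ENNReal.ofReal K * (eLpNorm h (ENNReal.ofReal p) volume + ENNReal.ofReal (ρ ^ (-α))) ≤
        ENNReal.ofReal M := by
      refine (mul_le_mul_right (add_le_add_left hhn _) _).trans ?_
      rw [← ENNReal.ofReal_add (by positivity) (by positivity), ← ENNReal.ofReal_mul hK.le]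
      apply ENNReal.ofReal_le_ofReal
      rw [hM, hC₁, mul_assoc]
      gcongr
      have : 0 ≤ G / A := by positivity
      linarith
    exact this.trans_lt ((ENNReal.ofReal_lt_ofReal_iff (by positivity)).2 (by linarith))
  obtain ⟨N', hN', hpair⟩ := exists_null_of_homNorm_lt hΩ.measurableSet hnorm
  have hNN : volume (N ∪ N') = 0 := measure_union_null hN hN'
  -- The Hölder bound for `v` has its own null set `N'`, which depends on `x` and `y` through `v`.
  -- Continuity of `u` off `N` lets `x` and `y` be moved off `N'` at a cost of `1 / 4` each, leaving
  -- an oscillation of at least `1 / 2`.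
  have happ : ∀ z ∈ Ω \ N, ∃ z' ∈ Ω \ N', dist z z' ≤ r / 2 ∧ |w z - w z'| ≤ 1 / 4 := by
    intro z hz
    obtain ⟨δ, hδ, hball⟩ := exists_ball_abs_sub_le hσ hα hΩ hN hF hF0 hg hz
      (show 0 < A / 4 by positivity)
    obtain ⟨z', hz', hz'N⟩ := exists_mem_ball_notMem hNN z (show 0 < min δ (r / 2) by positivity)
    rw [Metric.mem_ball', lt_min_iff] at hz'
    simp only [Set.mem_union, not_or] at hz'N
    obtain ⟨h1, h2⟩ := hball z' (Metric.mem_ball'.2 hz'.1)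
    refine ⟨z', ⟨h1, hz'N.2⟩, hz'.2.le, (hwu _ _).trans ?_⟩
    rw [div_le_iff₀ hA0]
    linarith [h2 hz'N.1]
  obtain ⟨x', hx', hxx', hwx⟩ := happ x hx
  obtain ⟨y', hy', hyy', hwy⟩ := happ y hy
  have hRr : 4 * r ≤ ρ := by rw [hρ]; gcongr
  have hbx : v x' = w x' := by
    rw [hv]; simp only
    rw [bump_eq_one hρ0 (by rw [dist_comm]; linarith), one_mul]
  have hby : v y' = w y' := by
    rw [hv]; simp only
    rw [bump_eq_one hρ0, one_mul]
    have := dist_triangle x y y'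
    rw [dist_comm]
    linarith
  have hwx0 : w x = 0 := by rw [hw]; simp
  have hwy1 : w y = 1 := by rw [hw]; simp [div_self hd]
  have hhalf : 1 / 2 ≤ |v x' - v y'| := by
    rw [hbx, hby, abs_sub_comm]
    rw [hwx0] at hwx
    rw [hwy1] at hwy
    have h1 := abs_le.1 hwx
    have h2 := abs_le.1 hwy
    exact le_trans (by linarith [h1.1, h2.2]) (le_abs_self _)
  have hdist : dist x' y' ≤ 2 * r := by
    have h1 := dist_triangle x' x y'
    have h2 := dist_triangle x y y'
    rw [dist_comm x' x] at h1
    linarith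
  have hfinal : 1 / 2 ≤ (2 * r) ^ α * (2 * (2 * M)) := by
    refine hhalf.trans ((hpair x' hx' y' hy').trans ?_)
    gcongr
  have hone : 1 ≤ C₃ * R ^ (-α) + C₃ * r ^ α * (G / A) := by
    have hrr : r ^ α * ρ ^ (-α) = R ^ (-α) := by
      rw [hρ, Real.mul_rpow (by linarith) hr0.le, Real.rpow_neg hr0.le]
      field_simp
    have : (2 * r) ^ α * (2 * (2 * M)) =
        (C₃ * (r ^ α * ρ ^ (-α)) + C₃ * r ^ α * (G / A)) / 2 := by
      rw [hM, hC₃, Real.mul_rpow (by norm_num) hr0.le]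
      ring
    rw [this, hrr] at hfinal
    linarith
  have hlast : A * (1 / 2) ≤ C₃ * r ^ α * G := by
    have h1 : 1 / 2 ≤ C₃ * r ^ α * (G / A) := by linarith
    calc A * (1 / 2) ≤ A * (C₃ * r ^ α * (G / A)) := by gcongr
      _ = _ := by field_simp
  linarith

/-! ### Measure density and large scales in the inhomogeneous case. -/

/-- Inhomogeneous imbedding domains satisfy the measure density condition at every scale. -/
theorem IsInhomBallImbeddingDomain.exists_measure_inter_ball_ge {s p : ℝ} (hs : 0 < s)
    (hs1 : s ≤ 1) (hp : 0 < p) {Ω : Set (E n)} (hΩ : IsOpen Ω)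
    (h : IsInhomBallImbeddingDomain s p Ω) {ρ : ℝ} (hρ : 0 < ρ) :
    ∃ c : ℝ, 0 < c ∧ ∀ x ∈ Ω, c ≤ (volume (Ω ∩ Metric.ball x ρ)).toReal := by
  obtain ⟨K, hK, hle⟩ := h.inhomNorm_le
  set κ := K * ((2 / ρ) ^ s + 1) with hκ
  have hκ0 : 0 < κ := by positivity
  refine ⟨(1 / κ) ^ p, by positivity, fun x hx => ?_⟩
  set b := Ω ∩ Metric.ball x ρ with hb
  have hbm : MeasurableSet b := hΩ.measurableSet.inter measurableSet_ball
  have hbtop : volume b ≠ ∞ :=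
    ((measure_mono Set.inter_subset_right).trans_lt measure_ball_lt_top).ne
  -- Restricting the gradient to `b = Ω ∩ B(x, ρ)` makes both norms of the bump multiples of `|b| ^
  -- (1 / p)`. Its supremum norm is at least `1`, which bounds `|b|` from below.
  set h₁ : E n → ℝ := b.indicator fun _ => (2 / ρ) ^ s with hh₁
  have hh₁0 : ∀ z, 0 ≤ h₁ z := fun z => Set.indicator_nonneg (fun _ _ => by positivity) z
  have hgrad : IsBallGrad s Ω ∅ (bump x ρ) h₁ := by
    intro y hy z hz _
    by_cases hfar : ρ ≤ dist y x ∧ ρ ≤ dist z x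
    · rw [bump_eq_zero hρ hfar.1, bump_eq_zero hρ hfar.2, sub_zero, abs_zero]
      have := hh₁0 y
      have := hh₁0 z
      positivity
    have hsum1 : (2 / ρ) ^ s ≤ h₁ y + h₁ z := by
      rcases not_and_or.1 hfar with h | h
      · have : h₁ y = (2 / ρ) ^ s := Set.indicator_of_mem (show y ∈ b from ⟨hy.1, not_le.1 h⟩) _
        linarith [hh₁0 z]
      · have : h₁ z = (2 / ρ) ^ s := Set.indicator_of_mem (show z ∈ b from ⟨hz.1, not_le.1 h⟩) _
        linarith [hh₁0 y]
    calc _ ≤ (2 / ρ * dist y z) ^ s := by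
          rcases le_or_gt 1 (2 / ρ * dist y z) with hl | hl
          · refine le_trans ?_ (Real.one_le_rpow hl hs.le)
            rw [abs_le]
            constructor <;> linarith [bump_nonneg x ρ y, bump_nonneg x ρ z, bump_le_one x ρ y,
              bump_le_one x ρ z]
          · exact (abs_bump_sub_bump_le x hρ y z).trans
              (Real.self_le_rpow_of_le_one (by positivity) hl.le hs1)
      _ = dist y z ^ s * (2 / ρ) ^ s := by
          rw [Real.mul_rpow (by positivity) dist_nonneg, mul_comm]
      _ ≤ _ := by gcongr
  have hmain := hle (bump x ρ) h₁ ∅ (by simp) (continuous_bump x ρ).aestronglyMeasurable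
    (measurable_const.indicator hbm) hh₁0 hgrad
  have hp0 : ENNReal.ofReal p ≠ 0 := by simpa using hp
  have e1 : eLpNorm h₁ (ENNReal.ofReal p) volume =
      ENNReal.ofReal ((2 / ρ) ^ s * (volume b).toReal ^ (1 / p)) := by
    rw [hh₁, eLpNorm_indicator_const hbm hp0 ENNReal.ofReal_ne_top, ENNReal.toReal_ofReal hp.le,
      Real.enorm_eq_ofReal (by positivity), ENNReal.ofReal_mul (by positivity),
      ← ENNReal.ofReal_rpow_of_nonneg ENNReal.toReal_nonneg (by positivity),
      ENNReal.ofReal_toReal hbtop]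
  have e2 : eLpNorm (bump x ρ) (ENNReal.ofReal p) (volume.restrict Ω) ≤
      ENNReal.ofReal ((volume b).toReal ^ (1 / p)) := by
    rw [← eLpNorm_indicator_eq_eLpNorm_restrict hΩ.measurableSet]
    have h3 : eLpNorm (b.indicator fun _ => (1 : ℝ)) (ENNReal.ofReal p) volume =
        ENNReal.ofReal ((volume b).toReal ^ (1 / p)) := by
      rw [eLpNorm_indicator_const hbm hp0 ENNReal.ofReal_ne_top, ENNReal.toReal_ofReal hp.le,
        ← ENNReal.ofReal_rpow_of_nonneg ENNReal.toReal_nonneg (by positivity),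
        ENNReal.ofReal_toReal hbtop]
      simp
    rw [← h3]
    refine eLpNorm_mono_real fun z => ?_
    rw [Real.norm_eq_abs]
    by_cases hzΩ : z ∈ Ω
    · rw [Set.indicator_of_mem hzΩ, abs_of_nonneg (bump_nonneg _ _ _)]
      by_cases hz : z ∈ Metric.ball x ρ
      · rw [Set.indicator_of_mem (show z ∈ b from ⟨hzΩ, hz⟩)]
        exact bump_le_one _ _ _
      · rw [bump_eq_zero hρ (not_lt.1 hz)]
        exact Set.indicator_nonneg (fun _ _ => zero_le_one) _
    · rw [Set.indicator_of_notMem hzΩ, abs_zero]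
      exact Set.indicator_nonneg (fun _ _ => zero_le_one) _
  have hlow : 1 ≤ inhomNorm (s - n / p) ∞ Ω (bump x ρ) := by
    refine le_trans ?_ le_add_self
    by_contra! hlt
    rw [eLpNorm_exponent_top] at hlt
    have hae := ae_lt_of_essSup_lt (by simpa [eLpNormEssSup] using hlt)
    rw [ae_restrict_iff' hΩ.measurableSet, ae_iff] at hae
    obtain ⟨δ, hδ, hδΩ⟩ := Metric.isOpen_iff.1 hΩ x hx
    obtain ⟨y, hy, hyN⟩ := exists_mem_ball_notMem hae x (show 0 < min δ (ρ / 2) by positivity)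
    rw [Metric.mem_ball, lt_min_iff] at hy
    have h1 : ‖bump x ρ y‖ₑ < 1 := not_not.1 hyN (hδΩ hy.1)
    rw [bump_eq_one hρ hy.2.le] at h1
    simp at h1
  have hreal : 1 ≤ κ * (volume b).toReal ^ (1 / p) := by
    have h4 : (1 : ℝ≥0∞) ≤ ENNReal.ofReal (κ * (volume b).toReal ^ (1 / p)) := by
      refine (hlow.trans hmain).trans ?_
      rw [e1]
      refine (mul_le_mul_right (add_le_add_right e2 _) _).trans ?_
      rw [← ENNReal.ofReal_add (by positivity) (by positivity), ← ENNReal.ofReal_mul hK.le]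
      apply ENNReal.ofReal_le_ofReal
      rw [hκ]
      apply le_of_eq
      ring
    rwa [ENNReal.one_le_ofReal] at h4
  have h5 : 1 / κ ≤ (volume b).toReal ^ (1 / p) := by
    rw [div_le_iff₀ hκ0]; linarith
  calc (1 / κ) ^ p ≤ ((volume b).toReal ^ (1 / p)) ^ p := by gcongr
    _ = _ := by
      rw [← Real.rpow_mul ENNReal.toReal_nonneg, one_div_mul_cancel hp.ne', Real.rpow_one]

/-- In an inhomogeneous imbedding domain the localized Morrey inequality holds at all scales once
the gradient dominates the function itself. -/
theorem IsInhomBallImbeddingDomain.exists_global_morrey {s p σ : ℝ} {Ω : Set (E n)}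
    (h : IsInhomBallImbeddingDomain s p Ω) (hΩ : IsOpen Ω) (hs : 0 < s) (hs1 : s ≤ 1)
    (hp1 : 1 ≤ p) (hα : 0 < s - n / p) (hσ : 0 < σ) (hσp : σ ≤ p) :
    ∃ C R : ℝ, 0 < C ∧ 1 ≤ R ∧ ∀ (N : Set (E n)) (u F : E n → ℝ), volume N = 0 →
      AEStronglyMeasurable u (volume.restrict Ω) → Measurable F →
      (∀ z ρ, MemLp F (ENNReal.ofReal σ) (volume.restrict (Metric.ball z ρ))) → (∀ y, 0 ≤ F y) →
      IsBallGrad (s - n / p + n / σ) Ω N u F → (∀ x ∈ Ω \ N, |u x| ≤ F x) →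
      (∀ x ∈ Ω \ N, ∀ y ∈ Ω \ N,
        |u x - u y| ≤ C * dist x y ^ (s - n / p) * locNorm σ F x (R * dist x y)) ∧
      ∀ x ∈ Ω \ N, |u x| ≤ C * locNorm σ F x R := by
  have hp : 0 < p := by linarith
  obtain ⟨K, hK, hT⟩ := h.exists_testImbedding hs hp
  obtain ⟨C, R, hC, hR, hmor⟩ := hT.exists_local_morrey hK hΩ hs hs1 hp1 hα hσ hσp
  set α := s - n / p with hαdef
  have hR0 : 0 < R := by linarith
  -- The radius `1 / R` is the range where the local Morrey inequality applies. Density yields a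
  -- point `y` there with `|u y| ≤ F y` at most a multiple of a local norm, and Morrey carries the
  -- bound to `x`.
  obtain ⟨c, hc, hdens⟩ := h.exists_measure_inter_ball_ge hs hs1 hp hΩ
    (ρ := 1 / R) (by positivity)
  set C₁ := (1 / c) ^ (1 / σ) + C * (1 / R) ^ α with hC₁
  have hC₁0 : 0 < C₁ := by positivity
  refine ⟨C + C₁ + 2 * C₁ * R ^ α, 4 * R + 1, by positivity, by linarith,
    fun N u F hN hu hFm hF hF0 hg huF => ?_⟩
  have hsup : ∀ x ∈ Ω \ N, |u x| ≤ C₁ * locNorm σ F x 4 := by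
    intro x hx
    have hL0 : 0 ≤ locNorm σ F x 4 := locNorm_nonneg _ _ _ _
    have hdx := hdens x hx.1
    obtain ⟨y, hy, hyN, hyF⟩ := exists_abs_mul_le_locNorm hσ (hF x (1 / R))
      (hΩ.measurableSet.inter measurableSet_ball) Set.inter_subset_right
      (fun h0 => by rw [h0, ENNReal.toReal_zero] at hdx; linarith) hN
    have hR1 : 1 / R ≤ 4 := by
      rw [div_le_iff₀ hR0]; linarith
    have hF4 : F y ≤ (1 / c) ^ (1 / σ) * locNorm σ F x 4 := by
      have h1 : F y * c ^ (1 / σ) ≤ locNorm σ F x 4 := by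
        refine le_trans ?_ (hyF.trans (locNorm_mono (hF _ _) (by rw [dist_self]; linarith)))
        rw [abs_of_nonneg (hF0 y)]
        have := hF0 y
        gcongr
      rw [Real.div_rpow zero_le_one hc.le, Real.one_rpow, one_div, inv_mul_eq_div,
        le_div_iff₀ (by positivity)]
      exact h1
    have hdist : dist x y ≤ 1 / R := (Metric.mem_ball'.1 hy.2).le
    have hRd : R * dist x y ≤ 1 := by
      calc R * dist x y ≤ R * (1 / R) := by gcongr
        _ = 1 := by field_simp
    have h2 := hmor N u F hN hu hFm hF hF0 hg x hx y ⟨hy.1, hyN⟩ hRd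
    have h3 : |u x - u y| ≤ C * (1 / R) ^ α * locNorm σ F x 4 := by
      refine h2.trans ?_
      gcongr
      · exact locNorm_nonneg _ _ _ _
      · exact locNorm_mono (hF _ _) (by rw [dist_self]; linarith)
    have h4 := huF y ⟨hy.1, hyN⟩
    have h5 := abs_sub_abs_le_abs_sub (u x) (u y)
    rw [hC₁, add_mul]
    linarith
  have hRα0 : 0 ≤ 2 * C₁ * R ^ α := by positivity
  refine ⟨fun x hx y hy => ?_, fun x hx => ?_⟩
  · set r := dist x y with hr
    have hr0 : 0 ≤ r := dist_nonneg
    have hmono : ∀ ρ : ℝ, ρ ≤ (4 * R + 1) * r → locNorm σ F x ρ ≤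
        locNorm σ F x ((4 * R + 1) * r) := fun ρ hρ =>
      locNorm_mono (hF _ _) (by rw [dist_self]; linarith)
    have hL0 : 0 ≤ locNorm σ F x ((4 * R + 1) * r) := locNorm_nonneg _ _ _ _
    -- For `R * r > 1` the two sup bounds suffice, since `(R * r) ^ α ≥ 1`; the balls of radius `4`
    -- about `x` and `y` lie in the ball of radius `(4 * R + 1) * r` about `x`.
    rcases le_or_gt (R * r) 1 with hsmall | hlarge
    · refine (hmor N u F hN hu hFm hF hF0 hg x hx y hy hsmall).trans ?_
      have := hmono (4 * (R * r)) (by linarith)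
      gcongr
      · exact locNorm_nonneg _ _ _ _
      · linarith
    · have h1 := hsup x hx
      have h2 := hsup y hy
      have h3 : locNorm σ F x 4 ≤ locNorm σ F x ((4 * R + 1) * r) := hmono 4 (by linarith)
      have h4 : locNorm σ F y 4 ≤ locNorm σ F x ((4 * R + 1) * r) :=
        locNorm_mono (hF _ _) (by rw [dist_comm]; linarith)
      have h5 : |u x - u y| ≤ 2 * C₁ * locNorm σ F x ((4 * R + 1) * r) := by
        have h6 := abs_sub (u x) (u y)
        have h7 : C₁ * locNorm σ F x 4 ≤ C₁ * locNorm σ F x ((4 * R + 1) * r) := by gcongr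
        have h8 : C₁ * locNorm σ F y 4 ≤ C₁ * locNorm σ F x ((4 * R + 1) * r) := by gcongr
        linarith
      have h6 : 1 ≤ R ^ α * r ^ α := by
        rw [← Real.mul_rpow hR0.le hr0]
        exact Real.one_le_rpow hlarge.le hα.le
      calc _ ≤ 2 * C₁ * locNorm σ F x ((4 * R + 1) * r) * 1 := by rw [mul_one]; exact h5
        _ ≤ 2 * C₁ * locNorm σ F x ((4 * R + 1) * r) * (R ^ α * r ^ α) := by gcongr
        _ = 2 * C₁ * R ^ α * r ^ α * locNorm σ F x ((4 * R + 1) * r) := by ring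
        _ ≤ _ := by
          gcongr
          linarith
  · refine (hsup x hx).trans ?_
    have h1 : locNorm σ F x 4 ≤ locNorm σ F x (4 * R + 1) :=
      locNorm_mono (hF _ _) (by rw [dist_self]; linarith)
    have := locNorm_nonneg σ F x 4
    gcongr
    linarith

/-! ### Tent-weighted norms and the McShane type extension. -/

/-- A Lipschitz weight that is at least `1` on the ball of radius `ρ` and vanishes off the ball of
radius `2 ρ`. -/
def tent (z : E n) (ρ : ℝ) (ξ : E n) : ℝ := max 0 (2 - dist ξ z / ρ)

theorem tent_nonneg (z : E n) (ρ : ℝ) (ξ : E n) : 0 ≤ tent z ρ ξ := le_max_left _ _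

theorem continuous_tent (z : E n) (ρ : ℝ) : Continuous (tent z ρ) := by
  unfold tent
  fun_prop

theorem tent_le_indicator {z : E n} {ρ : ℝ} (hρ : 0 < ρ) (ξ : E n) :
    tent z ρ ξ ≤ (Metric.ball z (2 * ρ)).indicator (fun _ => 2) ξ := by
  by_cases h : ξ ∈ Metric.ball z (2 * ρ)
  · rw [Set.indicator_of_mem h]
    have : 0 ≤ dist ξ z / ρ := by positivity
    exact max_le (by norm_num) (by linarith)
  · rw [Set.indicator_of_notMem h]
    rw [Metric.mem_ball, not_lt] at h
    have : 2 ≤ dist ξ z / ρ := by rwa [le_div_iff₀ hρ]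
    exact max_le le_rfl (by linarith)

theorem indicator_le_tent {z : E n} {ρ : ℝ} (hρ : 0 < ρ) (ξ : E n) :
    (Metric.ball z ρ).indicator (fun _ => 1) ξ ≤ tent z ρ ξ := by
  by_cases h : ξ ∈ Metric.ball z ρ
  · rw [Set.indicator_of_mem h]
    rw [Metric.mem_ball] at h
    have : dist ξ z / ρ ≤ 1 := by rw [div_le_one hρ]; exact h.le
    exact le_max_of_le_right (by linarith)
  · rw [Set.indicator_of_notMem h]
    exact tent_nonneg _ _ _

theorem tent_mono {z : E n} {ρ ρ' : ℝ} (hρ : 0 < ρ) (h : ρ ≤ ρ') (ξ : E n) :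
    tent z ρ ξ ≤ tent z ρ' ξ := by
  unfold tent
  gcongr

/-- After scaling, the weight is `max 0 (2 * ρ - dist ξ z)`, which is Lipschitz in centre and
radius. Indicators of balls lack this, which is the reason for using tents. -/
theorem mul_tent_le {z w : E n} {ρ ρ' : ℝ} (hρ : 0 < ρ) (h : ρ ≤ ρ') (ξ : E n) :
    ρ' * tent w ρ' ξ ≤ ρ * tent z ρ ξ +
      (Metric.ball w (2 * ρ')).indicator (fun _ => 2 * (ρ' - ρ) + dist z w) ξ := by
  have hρ' : 0 < ρ' := hρ.trans_le h
  by_cases hξ : ξ ∈ Metric.ball w (2 * ρ')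
  · rw [Set.indicator_of_mem hξ]
    have h1 : ρ' * tent w ρ' ξ = max 0 (2 * ρ' - dist ξ w) := by
      rw [tent, mul_max_of_nonneg _ _ hρ'.le, mul_zero]
      congr 1
      field_simp
    have h2 : ρ * tent z ρ ξ = max 0 (2 * ρ - dist ξ z) := by
      rw [tent, mul_max_of_nonneg _ _ hρ.le, mul_zero]
      congr 1
      field_simp
    rw [h1, h2]
    have h3 := dist_triangle_right ξ w z
    have h4 := dist_triangle ξ w z
    rw [dist_comm w z] at h4
    have hd : 0 ≤ dist z w := dist_nonneg
    refine max_le ?_ ?_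
    · have := le_max_left 0 (2 * ρ - dist ξ z)
      linarith
    · have := le_max_right 0 (2 * ρ - dist ξ z)
      linarith
  · rw [Set.indicator_of_notMem hξ]
    have h1 := tent_le_indicator (z := w) hρ' ξ
    rw [Set.indicator_of_notMem hξ] at h1
    have h2 := tent_nonneg z ρ ξ
    have h3 : ρ' * tent w ρ' ξ ≤ 0 := mul_nonpos_of_nonneg_of_nonpos hρ'.le h1
    have h4 : 0 ≤ ρ * tent z ρ ξ := by positivity
    linarith

/-- The `L^σ` norm of `F` weighted by a tent. -/
def tentNorm (σ : ℝ) (F : E n → ℝ) (z : E n) (ρ : ℝ) : ℝ :=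
  (eLpNorm (fun ξ => tent z ρ ξ * F ξ) (ENNReal.ofReal σ) volume).toReal

theorem tentNorm_nonneg (σ : ℝ) (F : E n → ℝ) (z : E n) (ρ : ℝ) : 0 ≤ tentNorm σ F z ρ :=
  ENNReal.toReal_nonneg

theorem eLpNorm_indicator_const_mul {σ : ℝ} {F : E n → ℝ} {c : ℝ} (hc : 0 ≤ c) (z : E n) (ρ : ℝ) :
    eLpNorm (fun ξ => (Metric.ball z ρ).indicator (fun _ => c) ξ * F ξ) (ENNReal.ofReal σ)
      volume =
      ENNReal.ofReal c * eLpNorm F (ENNReal.ofReal σ) (volume.restrict (Metric.ball z ρ)) := by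
  rw [← Real.enorm_eq_ofReal hc, ← eLpNorm_const_smul,
    ← eLpNorm_indicator_eq_eLpNorm_restrict measurableSet_ball]
  congr 1
  ext ξ
  by_cases h : ξ ∈ Metric.ball z ρ
  · simp [Set.indicator_of_mem h]
  · simp [Set.indicator_of_notMem h]

theorem eLpNorm_tent_mul_le {σ : ℝ} {F : E n → ℝ}
    (hF : ∀ z ρ, MemLp F (ENNReal.ofReal σ) (volume.restrict (Metric.ball z ρ)))
    (hF0 : ∀ y, 0 ≤ F y) (z : E n) {ρ : ℝ} (hρ : 0 < ρ) :
    eLpNorm (fun ξ => tent z ρ ξ * F ξ) (ENNReal.ofReal σ) volume ≤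
      ENNReal.ofReal (2 * locNorm σ F z (2 * ρ)) := by
  rw [ENNReal.ofReal_mul (by norm_num), locNorm, ENNReal.ofReal_toReal (hF _ _).eLpNorm_ne_top,
    ← eLpNorm_indicator_const_mul (by norm_num)]
  refine eLpNorm_mono_real fun ξ => ?_
  rw [Real.norm_eq_abs, abs_of_nonneg (mul_nonneg (tent_nonneg _ _ _) (hF0 _))]
  have := hF0 ξ
  gcongr
  exact tent_le_indicator hρ ξ

theorem tentNorm_le {σ : ℝ} {F : E n → ℝ}
    (hF : ∀ z ρ, MemLp F (ENNReal.ofReal σ) (volume.restrict (Metric.ball z ρ)))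
    (hF0 : ∀ y, 0 ≤ F y) (z : E n) {ρ : ℝ} (hρ : 0 < ρ) :
    tentNorm σ F z ρ ≤ 2 * locNorm σ F z (2 * ρ) :=
  ENNReal.toReal_le_of_le_ofReal (mul_nonneg (by norm_num) (locNorm_nonneg _ _ _ _))
    (eLpNorm_tent_mul_le hF hF0 z hρ)

theorem locNorm_le_tentNorm {σ : ℝ} {F : E n → ℝ}
    (hF : ∀ z ρ, MemLp F (ENNReal.ofReal σ) (volume.restrict (Metric.ball z ρ)))
    (hF0 : ∀ y, 0 ≤ F y) (z : E n) {ρ : ℝ} (hρ : 0 < ρ) :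
    locNorm σ F z ρ ≤ tentNorm σ F z ρ := by
  refine ENNReal.toReal_mono
    ((eLpNorm_tent_mul_le hF hF0 z hρ).trans_lt ENNReal.ofReal_lt_top).ne ?_
  rw [← one_mul (eLpNorm F _ _), ← ENNReal.ofReal_one, ← eLpNorm_indicator_const_mul zero_le_one]
  refine eLpNorm_mono_real fun ξ => ?_
  rw [Real.norm_eq_abs, abs_of_nonneg (mul_nonneg
    (Set.indicator_nonneg (fun _ _ => zero_le_one) _) (hF0 _))]
  have := hF0 ξ
  gcongr
  exact indicator_le_tent hρ ξ

theorem tentNorm_mono {σ : ℝ} {F : E n → ℝ}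
    (hF : ∀ z ρ, MemLp F (ENNReal.ofReal σ) (volume.restrict (Metric.ball z ρ)))
    (hF0 : ∀ y, 0 ≤ F y) (z : E n) {ρ ρ' : ℝ} (hρ : 0 < ρ) (h : ρ ≤ ρ') :
    tentNorm σ F z ρ ≤ tentNorm σ F z ρ' := by
  refine ENNReal.toReal_mono
    ((eLpNorm_tent_mul_le hF hF0 z (hρ.trans_le h)).trans_lt ENNReal.ofReal_lt_top).ne
    (eLpNorm_mono_real fun ξ => ?_)
  rw [Real.norm_eq_abs, abs_of_nonneg (mul_nonneg (tent_nonneg _ _ _) (hF0 _))]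
  have := hF0 ξ
  gcongr
  exact tent_mono hρ h ξ

/-- Minkowski's inequality, with `σ ≥ 1`, applied to `mul_tent_le`. Changing the centre costs a term
proportional to the displacement, with coefficient `1` on the old norm; the infimum construction
needs that exact coefficient. -/
theorem mul_tentNorm_le {σ : ℝ} (hσ : 1 ≤ σ) {F : E n → ℝ} (hFm : Measurable F)
    (hF : ∀ z ρ, MemLp F (ENNReal.ofReal σ) (volume.restrict (Metric.ball z ρ)))
    (hF0 : ∀ y, 0 ≤ F y) (z w : E n) {ρ ρ' : ℝ} (hρ : 0 < ρ) (h : ρ ≤ ρ') :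
    ρ' * tentNorm σ F w ρ' ≤
      ρ * tentNorm σ F z ρ + (2 * (ρ' - ρ) + dist z w) * locNorm σ F w (2 * ρ') := by
  have hρ' : 0 < ρ' := hρ.trans_le h
  have hc : 0 ≤ 2 * (ρ' - ρ) + dist z w := by
    have : 0 ≤ dist z w := dist_nonneg
    linarith
  have hone : 1 ≤ ENNReal.ofReal σ := by
    rw [← ENNReal.ofReal_one]; exact ENNReal.ofReal_le_ofReal hσ
  have hsmul : ∀ (a : ℝ) (x : E n) (r : ℝ), 0 < a →
      eLpNorm (fun ξ => a * (tent x r ξ * F ξ)) (ENNReal.ofReal σ) volume =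
        ENNReal.ofReal a * eLpNorm (fun ξ => tent x r ξ * F ξ) (ENNReal.ofReal σ) volume := by
    intro a x r ha
    rw [← Real.enorm_eq_ofReal ha.le, ← eLpNorm_const_smul]
    rfl
  have hfin := ((eLpNorm_tent_mul_le hF hF0 z hρ).trans_lt ENNReal.ofReal_lt_top).ne
  have hsum : eLpNorm (fun ξ => ρ' * (tent w ρ' ξ * F ξ)) (ENNReal.ofReal σ) volume ≤
      eLpNorm (fun ξ => ρ * (tent z ρ ξ * F ξ)) (ENNReal.ofReal σ) volume +
      eLpNorm (fun ξ => (Metric.ball w (2 * ρ')).indicator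
        (fun _ => 2 * (ρ' - ρ) + dist z w) ξ * F ξ) (ENNReal.ofReal σ) volume := by
    refine le_trans (eLpNorm_mono_real fun ξ => ?_) (eLpNorm_add_le ?_ ?_ hone)
    · have h1 := mul_le_mul_of_nonneg_right (mul_tent_le (z := z) (w := w) hρ h ξ) (hF0 ξ)
      have h2 := tent_nonneg w ρ' ξ
      have h3 := hF0 ξ
      rw [Real.norm_eq_abs, abs_of_nonneg (by positivity)]
      simp only [Pi.add_apply]
      linarith
    · exact (((continuous_tent z ρ).measurable.mul hFm).const_mul ρ).aestronglyMeasurable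
    · exact ((measurable_const.indicator measurableSet_ball).mul hFm).aestronglyMeasurable
  rw [hsmul _ _ _ hρ', hsmul _ _ _ hρ, eLpNorm_indicator_const_mul hc] at hsum
  have hreal := ENNReal.toReal_mono (ENNReal.add_ne_top.2
    ⟨ENNReal.mul_ne_top ENNReal.ofReal_ne_top hfin,
      ENNReal.mul_ne_top ENNReal.ofReal_ne_top (hF _ _).eLpNorm_ne_top⟩) hsum
  rwa [ENNReal.toReal_add (ENNReal.mul_ne_top ENNReal.ofReal_ne_top hfin)
    (ENNReal.mul_ne_top ENNReal.ofReal_ne_top (hF _ _).eLpNorm_ne_top), ENNReal.toReal_mul,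
    ENNReal.toReal_mul, ENNReal.toReal_mul, ENNReal.toReal_ofReal hρ'.le,
    ENNReal.toReal_ofReal hρ.le, ENNReal.toReal_ofReal hc] at hreal

/-- A McShane type extension: a function on `S` that satisfies a localized Morrey inequality
extends to a function on the whole space whose increments are controlled by any majorant `m` of
the local norms. -/
theorem exists_mcshane_extension {σ α C R : ℝ} (hσ : 1 ≤ σ) (hα : 0 < α)
    (ht : α + n / σ ≤ 1) (hC : 0 < C) (hR : 1 ≤ R) :
    ∃ C' R' : ℝ, 0 < C' ∧ 1 ≤ R' ∧ ∀ (S : Set (E n)) (u F : E n → ℝ), S.Nonempty → Measurable F →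
      (∀ z ρ, MemLp F (ENNReal.ofReal σ) (volume.restrict (Metric.ball z ρ))) → (∀ y, 0 ≤ F y) →
      (∀ x ∈ S, ∀ y ∈ S, |u x - u y| ≤ C * dist x y ^ α * locNorm σ F x (R * dist x y)) →
      ∃ U : E n → ℝ, (∀ y ∈ S, U y = u y) ∧
        (∀ z, ∀ y ∈ S, |U z - u y| ≤ C' * dist z y ^ α * locNorm σ F z (R' * dist z y)) ∧
        ∀ (m : E n → ℝ) (z w : E n), (∀ ρ : ℝ, 0 < ρ → locNorm σ F z ρ ≤ ρ ^ ((n : ℝ) / σ) * m z) →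
          (∀ ρ : ℝ, 0 < ρ → locNorm σ F w ρ ≤ ρ ^ ((n : ℝ) / σ) * m w) →
          0 ≤ m z → 0 ≤ m w →
          |U z - U w| ≤ dist z w ^ (α + n / σ) * (C' * m z + C' * m w) := by
  set e := (n : ℝ) / σ with he
  have he0 : 0 ≤ e := by positivity
  -- If `dist z y ≤ dist z y' = D`, then `dist y y' ≤ 2 * D`, and the ball about `y` of radius `R *
  -- dist y y'` lies in the ball about `z` of radius `(2 * R + 1) * D`.
  set Q := 2 * R + 1 with hQ
  have hQ1 : 1 ≤ Q := by linarith
  have hQ0 : 0 < Q := by linarith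
  set K := C * 2 ^ α with hK
  have hK0 : 0 < K := by positivity
  set B := K * (2 * Q + 1) * 2 ^ e + 2 * K * Q ^ α * (2 * Q) ^ e with hB
  have hB0 : 0 < B := by positivity
  refine ⟨B + 2 * K * Q ^ α, 2 * Q, by positivity, by linarith,
    fun S u F hS hFm hF hF0 hu => ?_⟩
  set ker : E n → E n → ℝ := fun z y => K * (Q * dist z y) ^ α * tentNorm σ F z (Q * dist z y)
    with hker
  have hker0 : ∀ z y, 0 ≤ ker z y := fun z y => by
    have := tentNorm_nonneg σ F z (Q * dist z y)
    positivity
  have hself : ∀ z, ker z z = 0 := fun z => by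
    simp [hker, Real.zero_rpow hα.ne']
  have hle : ∀ z, ∀ y ∈ S, ∀ y' ∈ S, dist z y ≤ dist z y' → |u y - u y'| ≤ ker z y' := by
    intro z y hy y' hy' hd
    set D := dist z y' with hD
    have hD0 : 0 ≤ D := dist_nonneg
    rcases hD0.eq_or_lt with h0 | h0
    · have h1 : z = y' := dist_eq_zero.1 h0.symm
      have h2 : z = y := dist_eq_zero.1 (le_antisymm (h0 ▸ hd) dist_nonneg)
      rw [← h1, ← h2, sub_self, abs_zero]
      exact hker0 _ _
    have htri : dist y y' ≤ 2 * D := by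
      have := dist_triangle_left y y' z
      linarith
    have hloc : locNorm σ F y (R * dist y y') ≤ locNorm σ F z (Q * D) := by
      refine locNorm_mono (hF _ _) ?_
      have : R * dist y y' ≤ R * (2 * D) := by gcongr
      rw [dist_comm y z, hQ]
      linarith
    have hL := locNorm_le_tentNorm hF hF0 z (show 0 < Q * D by positivity)
    have hL0 := locNorm_nonneg σ F z (Q * D)
    have hL1 := locNorm_nonneg σ F y (R * dist y y')
    calc _ ≤ C * dist y y' ^ α * locNorm σ F y (R * dist y y') := hu y hy y' hy'
      _ ≤ C * (2 * D) ^ α * tentNorm σ F z (Q * D) := by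
          gcongr
          exact hloc.trans hL
      _ = K * (1 * D) ^ α * tentNorm σ F z (Q * D) := by
          rw [Real.mul_rpow (by norm_num) hD0, hK, one_mul]; ring
      _ ≤ K * (Q * D) ^ α * tentNorm σ F z (Q * D) := by
          have := tentNorm_nonneg σ F z (Q * D)
          gcongr
  have hpair : ∀ z, ∀ y ∈ S, ∀ y' ∈ S, |u y - u y'| ≤ ker z y + ker z y' := by
    intro z y hy y' hy'
    rcases le_total (dist z y) (dist z y') with h | h
    · linarith [hle z y hy y' hy' h, hker0 z y]
    · rw [abs_sub_comm]
      linarith [hle z y' hy' y hy h, hker0 z y']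
  have : Nonempty S := hS.to_subtype
  set U : E n → ℝ := fun z => ⨅ y : S, u y + ker z y with hU
  have hbdd : ∀ z, BddBelow (Set.range fun y : S => u y + ker z y) := by
    intro z
    obtain ⟨y, hy⟩ := hS
    refine ⟨u y - ker z y, ?_⟩
    rintro _ ⟨y', rfl⟩
    have := le_abs_self (u y - u y')
    linarith [hpair z y hy y' y'.2]
  have hUle : ∀ z, ∀ y ∈ S, U z ≤ u y + ker z y := fun z y hy => ciInf_le (hbdd z) ⟨y, hy⟩
  have hUge : ∀ z, ∀ y ∈ S, u y - ker z y ≤ U z := fun z y hy => by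
    refine le_ciInf fun y' => ?_
    have := le_abs_self (u y - u y')
    linarith [hpair z y hy y' y'.2]
  have hkerle : ∀ z y, ker z y ≤ 2 * K * Q ^ α * dist z y ^ α *
      locNorm σ F z (2 * Q * dist z y) := by
    intro z y
    rcases (dist_nonneg (x := z) (y := y)).eq_or_lt with h0 | h0
    · rw [dist_eq_zero.1 h0.symm, hself, dist_self, Real.zero_rpow hα.ne']
      simp
    · have h1 := tentNorm_le hF hF0 z (show 0 < Q * dist z y by positivity)
      calc ker z y ≤ K * (Q * dist z y) ^ α * (2 * locNorm σ F z (2 * (Q * dist z y))) := by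
            simp only [hker]
            gcongr
        _ = _ := by
            rw [Real.mul_rpow hQ0.le dist_nonneg, ← mul_assoc 2 Q]
            ring
  refine ⟨U, fun y hy => ?_, fun z y hy => ?_, ?_⟩
  · have h1 := hUle y y hy
    have h2 := hUge y y hy
    rw [hself] at h1 h2
    linarith
  · have h1 := hUle z y hy
    have h2 := hUge z y hy
    have h3 := hkerle z y
    have hL := locNorm_nonneg σ F z (2 * Q * dist z y)
    have h4 : 2 * K * Q ^ α * dist z y ^ α * locNorm σ F z (2 * Q * dist z y) ≤
        (B + 2 * K * Q ^ α) * dist z y ^ α * locNorm σ F z (2 * Q * dist z y) := by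
      gcongr
      linarith
    rw [abs_le]
    constructor <;> linarith
  · intro m
    -- It suffices to compare kernels for each fixed `y`: `ker w y ≤ ker z y + dist z w ^ (α + e) *
    -- (B * m w)`. Taking infima and exchanging `z` and `w` gives the two-sided bound.
    have hone : ∀ z w, z ≠ w → 0 ≤ m w →
        (∀ ρ : ℝ, 0 < ρ → locNorm σ F w ρ ≤ ρ ^ e * m w) →
        U w ≤ U z + dist z w ^ (α + e) * (B * m w) := by
      intro z w hzw hmw hm
      set d := dist z w with hd
      have hd0 : 0 < d := dist_pos.2 hzw
      rw [← sub_le_iff_le_add]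
      refine le_ciInf fun y => ?_
      rw [sub_le_iff_le_add]
      refine (hUle w y y.2).trans ?_
      rw [add_assoc]
      gcongr
      set B₁ := K * (2 * Q + 1) * 2 ^ e with hB₁
      set B₂ := 2 * K * Q ^ α * (2 * Q) ^ e with hB₂
      have hB₁0 : 0 ≤ B₁ := by positivity
      have hB₂0 : 0 ≤ B₂ := by positivity
      -- The case `y = z` is separate because the main estimate uses the power `α - 1 ≤ 0` of `ρ = Q
      -- * dist z y`.
      rcases (dist_nonneg (x := z) (y := (y : E n))).eq_or_lt with h0 | h0
      · have hzy : (y : E n) = z := (dist_eq_zero.1 h0.symm).symm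
        rw [hzy, hself, zero_add]
        refine (hkerle w z).trans ?_
        rw [dist_comm w z, ← hd]
        calc _ ≤ 2 * K * Q ^ α * d ^ α * ((2 * Q * d) ^ e * m w) := by
              gcongr
              exact hm _ (by positivity)
          _ = d ^ (α + e) * (B₂ * m w) := by
              rw [Real.mul_rpow (by positivity) hd0.le, Real.rpow_add hd0, hB₂]
              ring
          _ ≤ _ := by
              gcongr
              linarith
      · set ρ := Q * dist z y with hρ
        have hρ0 : 0 < ρ := by positivity
        set ρ' := ρ + Q * d with hρ'
        have hQd : d ≤ Q * d := le_mul_of_one_le_left hd0.le hQ1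
        have hρ'0 : 0 < ρ' := by positivity
        have hρρ' : ρ ≤ ρ' := by linarith
        have hdρ' : d ≤ ρ' := by linarith
        have hw : Q * dist w y ≤ ρ' := by
          have := dist_triangle_left w (y : E n) z
          calc Q * dist w y ≤ Q * (d + dist z y) := by gcongr
            _ = ρ' := by rw [hρ', hρ]; ring
        have hT0 := tentNorm_nonneg σ F w ρ'
        have hT1 := tentNorm_nonneg σ F z ρ
        have h1 : ker w y ≤ K * (ρ' ^ (α - 1) * (ρ' * tentNorm σ F w ρ')) := by
          have hr : ρ' ^ (α - 1) * (ρ' * tentNorm σ F w ρ') = ρ' ^ α * tentNorm σ F w ρ' := by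
            rw [← mul_assoc, Real.rpow_sub_one hρ'0.ne', div_mul_cancel₀ _ hρ'0.ne']
          rw [hr, ← mul_assoc]
          rcases (dist_nonneg (x := w) (y := (y : E n))).eq_or_lt with h | h
          · rw [show ker w y = 0 by simp [hker, ← h, Real.zero_rpow hα.ne']]
            positivity
          · have h2 := tentNorm_mono hF hF0 w (show 0 < Q * dist w y by positivity) hw
            simp only [hker]
            have h3 := tentNorm_nonneg σ F w (Q * dist w y)
            gcongr
        have h2 := mul_tentNorm_le hσ hFm hF hF0 z w hρ0 hρρ'
        rw [← hd] at h2
        have h3 : 2 * (ρ' - ρ) + d = (2 * Q + 1) * d := by rw [hρ']; ring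
        rw [h3] at h2
        have h4 : ρ' ^ (α - 1) ≤ ρ ^ (α - 1) :=
          Real.rpow_le_rpow_of_nonpos hρ0 hρρ' (by linarith)
        have h5 : locNorm σ F w (2 * ρ') ≤ 2 ^ e * ρ' ^ e * m w := by
          rw [← Real.mul_rpow (by norm_num) hρ'0.le]
          exact hm _ (by positivity)
        -- Here `α + e ≤ 1` is essential: the power `α - 1 + e` is nonpositive, so `ρ'` may be
        -- replaced by the smaller `d`.
        have h6 : ρ' ^ (α - 1) * ρ' ^ e * d ≤ d ^ (α + e) := by
          rw [← Real.rpow_add hρ'0]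
          calc ρ' ^ (α - 1 + e) * d ≤ d ^ (α - 1 + e) * d :=
                mul_le_mul_of_nonneg_right
                  (Real.rpow_le_rpow_of_nonpos hd0 hdρ' (by linarith)) hd0.le
            _ = d ^ (α + e) := by
                rw [← Real.rpow_add_one hd0.ne']; congr 1; ring
        have hL0 := locNorm_nonneg σ F w (2 * ρ')
        calc ker w y ≤ K * (ρ' ^ (α - 1) * (ρ' * tentNorm σ F w ρ')) := h1
          _ ≤ K * (ρ' ^ (α - 1) * (ρ * tentNorm σ F z ρ + (2 * Q + 1) * d *
              (2 ^ e * ρ' ^ e * m w))) := by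
              gcongr
              refine h2.trans ?_
              gcongr
          _ = K * (ρ' ^ (α - 1) * (ρ * tentNorm σ F z ρ)) +
              B₁ * m w * (ρ' ^ (α - 1) * ρ' ^ e * d) := by rw [hB₁]; ring
          _ ≤ K * (ρ ^ (α - 1) * (ρ * tentNorm σ F z ρ)) + B₁ * m w * d ^ (α + e) := by
              gcongr
          _ = ker z y + d ^ (α + e) * (B₁ * m w) := by
              rw [← mul_assoc (ρ ^ (α - 1)), Real.rpow_sub_one hρ0.ne',
                div_mul_cancel₀ _ hρ0.ne']
              simp only [hker]
              ring
          _ ≤ _ := by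
              gcongr
              linarith
    intro z w hz hw hmz hmw
    rcases eq_or_ne z w with rfl | hzw
    · simp only [sub_self, abs_zero]
      positivity
    have h1 := hone z w hzw hmw hw
    have h2 := hone w z hzw.symm hmz hz
    rw [dist_comm w z] at h2
    have h3 : 0 ≤ dist z w ^ (α + e) := by positivity
    have hB' : B ≤ B + 2 * K * Q ^ α := by
      have : 0 ≤ 2 * K * Q ^ α := by positivity
      linarith
    have h4 : dist z w ^ (α + e) * (B * m w) ≤
        dist z w ^ (α + e) * ((B + 2 * K * Q ^ α) * m w) := by gcongr
    have h5 : dist z w ^ (α + e) * (B * m z) ≤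
        dist z w ^ (α + e) * ((B + 2 * K * Q ^ α) * m z) := by gcongr
    have h6 : 0 ≤ dist z w ^ (α + e) * ((B + 2 * K * Q ^ α) * m w) := by positivity
    have h7 : 0 ≤ dist z w ^ (α + e) * ((B + 2 * K * Q ^ α) * m z) := by positivity
    rw [mul_add, abs_le]
    constructor <;> linarith

/-! ### Measurability, restriction and the reduction to bounded extension. -/

/-- A function with a measurable Hajłasz gradient on the whole space is measurable. -/
theorem aestronglyMeasurable_of_hajlasz {t : ℝ} (ht : 0 < t) {U m : E n → ℝ} (hm : Measurable m)
    {Z : Set (E n)} (hZ : volume Z = 0)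
    (hU : ∀ z ∉ Z, ∀ w ∉ Z, |U z - U w| ≤ dist z w ^ t * (m z + m w)) :
    AEStronglyMeasurable U volume := by
  set Y := toMeasurable volume Z with hY
  have hYm : MeasurableSet Y := measurableSet_toMeasurable _ _
  have hY0 : volume Y = 0 := by rw [hY, measure_toMeasurable, hZ]
  -- On each `A k` the function is Hölder with constant `2 * k`, hence continuous, and these sets
  -- exhaust the space up to a null set.
  set A : ℕ → Set (E n) := fun k => {x | m x ≤ k} \ Y with hA
  have hAm : ∀ k, MeasurableSet (A k) := fun k =>
    (measurableSet_le hm measurable_const).diff hYm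
  have hcover : ⋃ k, A k = Yᶜ := by
    ext x
    simp only [hA, Set.mem_iUnion]
    constructor
    · rintro ⟨k, hk⟩
      exact hk.2
    · intro hx
      obtain ⟨k, hk⟩ := exists_nat_ge (m x)
      exact ⟨k, hk, hx⟩
  have hcont : ∀ k, ContinuousOn U (A k) := by
    intro k x hx
    rw [ContinuousWithinAt, tendsto_iff_dist_tendsto_zero]
    have hlim : Filter.Tendsto (fun y => dist y x ^ t * (2 * k)) (nhdsWithin x (A k))
        (nhds 0) := by
      have h1 : Continuous fun y : E n => dist y x ^ t * (2 * (k : ℝ)) := by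
        have : Continuous fun y : E n => dist y x ^ t :=
          (continuous_id.dist continuous_const).rpow_const fun _ => Or.inr ht.le
        fun_prop
      have h2 := (h1.tendsto x).mono_left (nhdsWithin_le_nhds (s := A k))
      simpa [Real.zero_rpow ht.ne'] using h2
    refine squeeze_zero' (Filter.Eventually.of_forall fun _ => dist_nonneg) ?_ hlim
    filter_upwards [self_mem_nhdsWithin] with y hy
    rw [Real.dist_eq]
    refine (hU y (fun h => hy.2 (subset_toMeasurable _ _ h)) x
      (fun h => hx.2 (subset_toMeasurable _ _ h))).trans ?_
    gcongr
    have h1 : m y ≤ k := hy.1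
    have h2 : m x ≤ k := hx.1
    linarith
  have hres : AEStronglyMeasurable U (volume.restrict (⋃ k, A k)) :=
    aestronglyMeasurable_iUnion_iff.2 fun k => (hcont k).aestronglyMeasurable (hAm k)
  rwa [hcover, Measure.restrict_eq_self_of_ae_mem] at hres
  rw [ae_iff]
  simpa using hY0

/-- The absolute value of a function that is measurable on `Ω`, extended by zero. -/
theorem exists_measurable_extension_abs {Ω : Set (E n)} (hΩ : MeasurableSet Ω) {g : E n → ℝ}
    (hg : AEStronglyMeasurable g (volume.restrict Ω)) :
    ∃ (F : E n → ℝ) (N : Set (E n)), Measurable F ∧ (∀ x, 0 ≤ F x) ∧ volume N = 0 ∧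
      (∀ x ∈ Ω \ N, F x = |g x|) ∧
      ∀ p : ℝ≥0∞, eLpNorm F p volume = eLpNorm g p (volume.restrict Ω) := by
  set g' := hg.mk g with hg'
  have hae := hg.ae_eq_mk
  have hN := (ae_restrict_iff' hΩ).1 hae
  rw [ae_iff] at hN
  refine ⟨Ω.indicator fun x => |g' x|, _,
    (continuous_abs.measurable.comp hg.stronglyMeasurable_mk.measurable).indicator hΩ,
    fun x => Set.indicator_nonneg (fun _ _ => abs_nonneg _) x, hN, fun x hx => ?_, fun p => ?_⟩
  · have h1 : g x = g' x := not_not.1 hx.2 hx.1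
    rw [Set.indicator_of_mem hx.1, h1]
  · rw [eLpNorm_indicator_eq_eLpNorm_restrict hΩ, eLpNorm_congr_ae hae]
    exact eLpNorm_norm g'

theorem exists_isBallGrad_of_mem_ballGrads {t : ℝ} {Ω : Set (E n)} (hΩ : MeasurableSet Ω)
    {u g : E n → ℝ} (hg : g ∈ ballGrads t Ω u) :
    ∃ (F : E n → ℝ) (N : Set (E n)), Measurable F ∧ (∀ x, 0 ≤ F x) ∧ volume N = 0 ∧
      IsBallGrad t Ω N u F ∧
      ∀ p : ℝ≥0∞, eLpNorm F p volume = eLpNorm g p (volume.restrict Ω) := by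
  obtain ⟨hgm, hg0, N, hN, hineq⟩ := hg
  obtain ⟨F, N', hF, hF0, hN', hFg, hnorm⟩ := exists_measurable_extension_abs hΩ hgm
  refine ⟨F, N ∪ N', hF, hF0, measure_union_null hN hN', fun x hx y hy hxy => ?_, hnorm⟩
  simp only [Set.mem_sdiff, Set.mem_union, not_or] at hx hy
  rw [hFg x ⟨hx.1, hx.2.2⟩, hFg y ⟨hy.1, hy.2.2⟩, abs_of_nonneg (hg0 x hx.1),
    abs_of_nonneg (hg0 y hy.1)]
  exact hineq x ⟨hx.1, hx.2.1⟩ y ⟨hy.1, hy.2.1⟩ hxy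

theorem homBallNorm_le_of_hajlasz {t : ℝ} {p : ℝ≥0∞} {U m : E n → ℝ} {Z : Set (E n)}
    (hm : Measurable m) (hm0 : ∀ x, 0 ≤ m x) (hZ : volume Z = 0)
    (h : ∀ z ∉ Z, ∀ w ∉ Z, |U z - U w| ≤ dist z w ^ t * (m z + m w)) :
    homBallNorm t p Set.univ U ≤ eLpNorm m p volume := by
  have hmem : m ∈ ballGrads t Set.univ U :=
    ⟨hm.aestronglyMeasurable, fun x _ => hm0 x, Z, hZ, fun x hx y hy _ => h x hx.2 y hy.2⟩
  refine (iInf₂_le m hmem).trans ?_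
  rw [Measure.restrict_univ]

/-- Restriction to `Ω` does not increase the homogeneous norm of ball type. -/
theorem homBallNorm_restrict_le {t : ℝ} {p : ℝ≥0∞} {Ω : Set (E n)} (hΩ : MeasurableSet Ω)
    {u v : E n → ℝ} (huv : u =ᵐ[volume.restrict Ω] v) :
    homBallNorm t p Ω v ≤ homBallNorm t p Set.univ u := by
  refine le_iInf₂ fun g hg => ?_
  obtain ⟨hgm, hg0, N, hN, hineq⟩ := hg
  rw [Measure.restrict_univ] at hgm
  have hN' := (ae_restrict_iff' hΩ).1 huv
  rw [ae_iff] at hN'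
  have hmem : g ∈ ballGrads t Ω v := by
    refine ⟨hgm.restrict, fun x _ => hg0 x trivial, N ∪ _, measure_union_null hN hN',
      fun x hx y hy _ => ?_⟩
    simp only [Set.mem_sdiff, Set.mem_union, not_or] at hx hy
    have hx' : u x = v x := not_not.1 hx.2.2 hx.1
    have hy' : u y = v y := not_not.1 hy.2.2 hy.1
    rw [← hx', ← hy']
    refine hineq x ⟨trivial, hx.2.1⟩ y ⟨trivial, hy.2.1⟩ ?_
    rw [frontier_univ, Metric.infEDist_empty, ENNReal.mul_top (by simp)]
    exact edist_lt_top x y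
  refine (iInf₂_le g hmem).trans ?_
  rw [Measure.restrict_univ]
  exact eLpNorm_mono_measure _ Measure.restrict_le_self

theorem inhomBallNorm_restrict_le {t : ℝ} {p : ℝ≥0∞} {Ω : Set (E n)} (hΩ : MeasurableSet Ω)
    {u v : E n → ℝ} (huv : u =ᵐ[volume.restrict Ω] v) :
    inhomBallNorm t p Ω v ≤ inhomBallNorm t p Set.univ u := by
  refine add_le_add (homBallNorm_restrict_le hΩ huv) ?_
  rw [← eLpNorm_congr_ae huv, Measure.restrict_univ]
  exact eLpNorm_mono_measure _ Measure.restrict_le_self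

/-- Restriction gives one norm inequality. The other also gives existence of extensions, because an
infimum over no extensions would be `∞`. -/
theorem isExtensionDomain_of_restrictionNorm_le {X : Set (E n) → (E n → ℝ) → ℝ≥0∞} {Ω : Set (E n)}
    (h1 : ∀ u v, u =ᵐ[volume.restrict Ω] v → X Ω v ≤ X Set.univ u) {C : ℝ≥0} (hC : 0 < C)
    (h2 : ∀ v, Mem X Ω v → restrictionNorm X Ω v ≤ C * X Ω v) : IsExtensionDomain X Ω := by
  have h3 : ∀ v, X Ω v ≤ restrictionNorm X Ω v := fun v => le_iInf₂ fun u hu => h1 u v hu.2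
  refine ⟨fun v => ⟨fun hv => ?_, ?_⟩, C + 1, by positivity, fun v hv => ⟨?_, ?_⟩⟩
  · have hlt : restrictionNorm X Ω v < ∞ :=
      (h2 v hv).trans_lt (ENNReal.mul_lt_top ENNReal.coe_lt_top hv.2)
    simp only [restrictionNorm, iInf_lt_iff] at hlt
    obtain ⟨u, hu, -⟩ := hlt
    exact ⟨u, hu⟩
  · rintro ⟨u, hu, huv⟩
    have hum := hu.1
    rw [Measure.restrict_univ] at hum
    exact ⟨hum.restrict.congr huv, (h1 u v huv).trans_lt hu.2⟩
  · refine (h3 v).trans (le_mul_of_one_le_left' ?_)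
    rw [ENNReal.coe_add, ENNReal.coe_one]
    exact le_add_self
  · refine (h2 v hv).trans ?_
    gcongr
    exact le_self_add

/-! ### The auxiliary exponent and the two extension theorems. -/

/-- The relations between the exponents of the two spaces, with the auxiliary exponent `σ` for
which `t - n / σ = s - n / p`. -/
theorem exists_auxiliary_exponent (hn : 1 ≤ n) {s p t q : ℝ} (hs : 0 < s) (hs1 : s ≤ 1)
    (hp : (n : ℝ) / s < p) (hst : s ≤ t) (ht1 : t ≤ 1) (hq : (n : ℝ) / t < q)
    (hlt : s - (n : ℝ) / p < t - (n : ℝ) / q) :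
    ∃ σ : ℝ, 1 ≤ σ ∧ σ ≤ p ∧ σ < q ∧ 1 ≤ p ∧ 0 < s - n / p ∧ s - n / p + n / σ = t := by
  have hn1 : (1 : ℝ) ≤ n := by exact_mod_cast hn
  have hn0 : (0 : ℝ) < n := by linarith
  have ht : 0 < t := by linarith
  have hp0 : 0 < p := lt_trans (by positivity) hp
  have hq0 : 0 < q := lt_trans (by positivity) hq
  have hα : (n : ℝ) / p < s := (div_lt_comm₀ hs hp0).1 hp
  have hnp : 0 < (n : ℝ) / p := by positivity
  have hd : 0 < t - s + n / p := by linarith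
  -- This solves `t - n / σ = s - n / p`. Then `σ ≥ 1` because `n / σ ≤ t ≤ 1 ≤ n`, `σ ≤ p` because
  -- `s ≤ t`, and `σ < q` is the strict inequality between the smoothness indices.
  refine ⟨n / (t - s + n / p), ?_, ?_, ?_, ?_, by linarith, ?_⟩
  · rw [le_div_iff₀ hd]
    linarith
  · rw [div_le_comm₀ hd hp0]
    linarith
  · rw [div_lt_comm₀ hd hq0]
    linarith
  · have : 1 ≤ (n : ℝ) / s := by
      rw [le_div_iff₀ hs]
      linarith
    linarith
  · rw [div_div_cancel₀ hn0.ne']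
    ring

theorem nonempty_diff_of_null {Ω N : Set (E n)} (hΩ : IsOpen Ω) (hne : Ω.Nonempty)
    (hN : volume N = 0) : (Ω \ N).Nonempty := by
  obtain ⟨x, hx⟩ := hne
  obtain ⟨δ, hδ, hsub⟩ := Metric.isOpen_iff.1 hΩ x hx
  obtain ⟨y, hy, hyN⟩ := exists_mem_ball_notMem hN x hδ
  exact ⟨y, hsub hy, hyN⟩

theorem ae_restrict_eq_of_forall_diff {Ω N : Set (E n)} (hΩ : MeasurableSet Ω)
    (hN : volume N = 0) {u v : E n → ℝ} (h : ∀ y ∈ Ω \ N, u y = v y) :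
    u =ᵐ[volume.restrict Ω] v := by
  refine (ae_restrict_iff' hΩ).2 ?_
  have : ∀ᵐ x, x ∉ N := by
    rw [ae_iff]
    simpa using hN
  filter_upwards [this] with x hx hxΩ
  exact h x ⟨hxΩ, hx⟩

theorem eLpNorm_const_mul_of_nonneg {c : ℝ} (hc : 0 ≤ c) (m : E n → ℝ) (p : ℝ≥0∞) :
    eLpNorm (fun x => c * m x) p volume = ENNReal.ofReal c * eLpNorm m p volume := by
  rw [← Real.enorm_eq_ofReal hc, ← eLpNorm_const_smul]
  rfl

/-- The Morrey inequality holds at all scales, so the McShane extension from `Ω` minus a null set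
already has a multiple of `m` as gradient. -/
theorem IsHomBallImbeddingDomain.isHomBallExtensionDomain (hn : 1 ≤ n) {Ω : Set (E n)}
    (hΩ : IsOpen Ω) (hne : Ω.Nonempty) {s p t q : ℝ} (hs : 0 < s) (hs1 : s ≤ 1)
    (hp : (n : ℝ) / s < p) (hst : s ≤ t) (ht1 : t ≤ 1) (hq : (n : ℝ) / t < q)
    (hlt : s - (n : ℝ) / p < t - (n : ℝ) / q) (h : IsHomBallImbeddingDomain s p Ω) :
    IsHomBallExtensionDomain t q Ω := by
  obtain ⟨σ, hσ1, hσp, hσq, hp1, hα, hασ⟩ :=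
    exists_auxiliary_exponent hn hs hs1 hp hst ht1 hq hlt
  have hσ : 0 < σ := by linarith
  obtain ⟨K, hK, hT⟩ := h.exists_testImbedding
  obtain ⟨C, R, hC, hR, hmor⟩ := hT.exists_local_morrey hK hΩ hs hs1 hp1 hα hσ hσp
  obtain ⟨C', R', hC', hR', hext⟩ := exists_mcshane_extension (n := n) hσ1 hα
    (hασ.le.trans ht1) hC (show 1 ≤ 4 * R by linarith)
  obtain ⟨Cm, hmax⟩ := exists_locNorm_le_rpow_mul hn hσ hσq
  rw [hασ] at hmor hext
  set D : ℝ≥0 := C'.toNNReal * Cm + 1 with hD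
  have hD0 : (D : ℝ≥0∞) ≠ 0 := by
    rw [hD]; exact_mod_cast (by positivity : C'.toNNReal * Cm + 1 ≠ 0)
  refine isExtensionDomain_of_restrictionNorm_le (C := D)
    (fun u v huv => homBallNorm_restrict_le hΩ.measurableSet huv) (by positivity) fun v hv => ?_
  -- The extension depends on the chosen gradient, so the bound is proved for each gradient
  -- separately, with a uniform constant, before taking the infimum.
  refine (ENNReal.div_le_iff' hD0 ENNReal.coe_ne_top).1 (le_iInf₂ fun g hg => ?_)
  refine ENNReal.div_le_of_le_mul' ?_
  obtain ⟨F, N, hFm, hF0, hN, hgrad, hnorm⟩ :=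
    exists_isBallGrad_of_mem_ballGrads hΩ.measurableSet hg
  rw [← hnorm]
  by_cases htop : eLpNorm F (ENNReal.ofReal q) volume = ∞
  · rw [htop, ENNReal.mul_top hD0]
    exact le_top
  have hFq : MemLp F (ENNReal.ofReal q) volume :=
    ⟨hFm.aestronglyMeasurable, lt_top_iff_ne_top.2 htop⟩
  have hF := memLp_restrict_ball hσq.le hFq
  obtain ⟨m, hmm, hm0, hmn, hmae⟩ := hmax F hFm hFq
  rw [ae_iff] at hmae
  set Z := {z | ¬∀ ρ : ℝ, 0 < ρ → locNorm σ F z ρ ≤ ρ ^ ((n : ℝ) / σ) * m z} with hZ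
  obtain ⟨U, hUv, -, hUm⟩ := hext (Ω \ N) v F (nonempty_diff_of_null hΩ hne hN) hFm hF hF0
    (fun x hx y hy => by
      have h1 := hmor N v F hN hv.1 hFm hF hF0 hgrad x hx y hy trivial
      rwa [← mul_assoc] at h1)
  have hUineq : ∀ z ∉ Z, ∀ w ∉ Z, |U z - U w| ≤ dist z w ^ t * (C' * m z + C' * m w) :=
    fun z hz w hw => hUm m z w (not_not.1 hz) (not_not.1 hw) (hm0 z) (hm0 w)
  have hm' : Measurable fun x => C' * m x := hmm.const_mul _
  have hUnorm : homBallNorm t (ENNReal.ofReal q) Set.univ U ≤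
      D * eLpNorm F (ENNReal.ofReal q) volume := by
    refine (homBallNorm_le_of_hajlasz hm' (fun x => mul_nonneg hC'.le (hm0 x)) hmae hUineq).trans ?_
    rw [eLpNorm_const_mul_of_nonneg hC'.le]
    refine (mul_le_mul_right hmn _).trans ?_
    rw [← mul_assoc, hD, ENNReal.coe_add, ENNReal.coe_mul]
    gcongr
    exact le_self_add
  have hUmeas := aestronglyMeasurable_of_hajlasz (hs.trans_le hst) hm' hmae hUineq
  have hUmem : Mem (homBallNorm t (ENNReal.ofReal q)) Set.univ U :=
    ⟨by rwa [Measure.restrict_univ], hUnorm.trans_lt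
      (ENNReal.mul_lt_top ENNReal.coe_lt_top hFq.2)⟩
  exact (iInf₂_le U ⟨hUmem, ae_restrict_eq_of_forall_diff hΩ.measurableSet hN hUv⟩).trans hUnorm

/-- A Lipschitz cutoff of a Hajłasz function that is controlled by its gradient near `S`. -/
theorem exists_cutoff_hajlasz {t C' C₆ : ℝ} (ht : 0 < t) (ht1 : t ≤ 1) (hC₆ : 0 ≤ C₆)
    {S Z : Set (E n)} (hS : S.Nonempty) {U m : E n → ℝ} (hm0 : ∀ x, 0 ≤ m x) (hC' : 0 ≤ C')
    (hU : ∀ z ∉ Z, ∀ w ∉ Z, |U z - U w| ≤ dist z w ^ t * (C' * m z + C' * m w))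
    (hUsup : ∀ z ∉ Z, (∃ y ∈ S, dist z y < 1) → |U z| ≤ C₆ * m z) :
    ∃ W : E n → ℝ, (∀ y ∈ S, W y = U y) ∧ (∀ z ∉ Z, |W z| ≤ C₆ * m z) ∧
      ∀ z ∉ Z, ∀ w ∉ Z,
        |W z - W w| ≤ dist z w ^ t * ((C' + C₆) * m z + (C' + C₆) * m w) := by
  set φ : E n → ℝ := fun z => max 0 (1 - Metric.infDist z S) with hφ
  have hφ0 : ∀ z, 0 ≤ φ z := fun z => le_max_left _ _
  have hφ1 : ∀ z, φ z ≤ 1 := fun z =>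
    max_le zero_le_one (by linarith [Metric.infDist_nonneg (x := z) (s := S)])
  have hφS : ∀ y ∈ S, φ y = 1 := fun y hy => by
    simp only [hφ]
    rw [Metric.infDist_zero_of_mem hy]
    simp
  have hφlip : ∀ z w, |φ z - φ w| ≤ dist z w := by
    intro z w
    simp only [hφ]
    rw [max_comm 0, max_comm 0]
    refine (abs_max_sub_max_le_abs _ _ _).trans ?_
    have h1 := Metric.infDist_le_infDist_add_dist (s := S) (x := z) (y := w)
    have h2 := Metric.infDist_le_infDist_add_dist (s := S) (x := w) (y := z)
    rw [dist_comm w z] at h2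
    rw [abs_le]
    constructor <;> linarith
  have hφt : ∀ z w, |φ z - φ w| ≤ dist z w ^ t := by
    intro z w
    rcases le_or_gt 1 (dist z w) with h | h
    · refine le_trans ?_ (Real.one_le_rpow h ht.le)
      rw [abs_le]
      constructor <;> linarith [hφ0 z, hφ0 w, hφ1 z, hφ1 w]
    · exact (hφlip z w).trans (Real.self_le_rpow_of_le_one dist_nonneg h.le ht1)
  have hsup : ∀ z ∉ Z, φ z ≠ 0 → |U z| ≤ C₆ * m z := by
    intro z hz hne
    refine hUsup z hz ((Metric.infDist_lt_iff hS).1 ?_)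
    by_contra! hcon
    exact hne (max_eq_left (by linarith))
  have hone : ∀ z ∉ Z, ∀ w ∉ Z, φ z ≠ 0 → |φ z * U z - φ w * U w| ≤
      dist z w ^ t * ((C' + C₆) * m z + (C' + C₆) * m w) := by
    intro z hz w hw hne
    -- In this splitting `U` itself is evaluated only at `z`, where `φ z ≠ 0` gives the bound by `C₆
    -- * m z`.
    have h1 : φ z * U z - φ w * U w = φ w * (U z - U w) + (φ z - φ w) * U z := by ring
    have h2 := hU z hz w hw
    have h3 := hsup z hz hne
    have h4 := hm0 z
    have h5 := hm0 w
    rw [h1]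
    refine (abs_add_le _ _).trans ?_
    rw [abs_mul, abs_mul, abs_of_nonneg (hφ0 w)]
    calc _ ≤ 1 * (dist z w ^ t * (C' * m z + C' * m w)) + dist z w ^ t * (C₆ * m z) := by
          gcongr
          · exact hφ1 w
          · exact hφt z w
      _ = dist z w ^ t * ((C' + C₆) * m z + C' * m w) := by ring
      _ ≤ _ := by
          gcongr
          linarith
  refine ⟨fun z => φ z * U z, fun y hy => by simp only [hφS y hy, one_mul], fun z hz => ?_,
    fun z hz w hw => ?_⟩
  · by_cases hne : φ z = 0
    · simp only [hne, zero_mul, abs_zero]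
      exact mul_nonneg hC₆ (hm0 z)
    · rw [abs_mul, abs_of_nonneg (hφ0 z)]
      exact (mul_le_of_le_one_left (abs_nonneg _) (hφ1 z)).trans (hsup z hz hne)
  · by_cases hz0 : φ z = 0
    · by_cases hw0 : φ w = 0
      · simp only [hz0, hw0, zero_mul, sub_zero, abs_zero]
        have h4 := hm0 z
        have h5 := hm0 w
        positivity
      · have h6 := hone w hw z hz hw0
        rw [abs_sub_comm, dist_comm, add_comm]
        exact h6
    · exact hone z hz w hw hz0

/-- The same majorant `m` controls the increments of the McShane extension and, within distance `1`
of the domain minus a null set, its values. A cutoff there gives both parts of the inhomogeneous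
norm. -/
theorem IsInhomBallImbeddingDomain.isInhomBallExtensionDomain (hn : 1 ≤ n) {Ω : Set (E n)}
    (hΩ : IsOpen Ω) (hne : Ω.Nonempty) {s p t q : ℝ} (hs : 0 < s) (hs1 : s ≤ 1)
    (hp : (n : ℝ) / s < p) (hst : s ≤ t) (ht1 : t ≤ 1) (hq : (n : ℝ) / t < q)
    (hlt : s - (n : ℝ) / p < t - (n : ℝ) / q) (h : IsInhomBallImbeddingDomain s p Ω) :
    IsInhomBallExtensionDomain t q Ω := by
  obtain ⟨σ, hσ1, hσp, hσq, hp1, hα, hασ⟩ :=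
    exists_auxiliary_exponent hn hs hs1 hp hst ht1 hq hlt
  have hσ : 0 < σ := by linarith
  have ht : 0 < t := hs.trans_le hst
  obtain ⟨C, R, hC, hR, hmor⟩ := h.exists_global_morrey hΩ hs hs1 hp1 hα hσ hσp
  obtain ⟨C', R', hC', hR', hext⟩ := exists_mcshane_extension (n := n) hσ1 hα
    (hασ.le.trans ht1) hC hR
  obtain ⟨Cm, hmax⟩ := exists_locNorm_le_rpow_mul hn hσ hσq
  rw [hασ] at hmor hext
  set C₆ := (C + C') * (R + 1 + R') ^ ((n : ℝ) / σ) with hC₆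
  have hC₆0 : 0 ≤ C₆ := by positivity
  set D : ℝ≥0 := (C' + C₆ + C₆).toNNReal * Cm + 1 with hD
  have hD0 : (D : ℝ≥0∞) ≠ 0 := by
    rw [hD]; exact_mod_cast (by positivity : (C' + C₆ + C₆).toNNReal * Cm + 1 ≠ 0)
  refine isExtensionDomain_of_restrictionNorm_le (C := D)
    (fun u v huv => inhomBallNorm_restrict_le hΩ.measurableSet huv) (by positivity) fun v hv => ?_
  refine (ENNReal.div_le_iff' hD0 ENNReal.coe_ne_top).1 ?_
  rw [inhomBallNorm, homBallNorm]
  simp only [ENNReal.iInf_add]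
  refine le_iInf₂ fun g hg => ?_
  refine ENNReal.div_le_of_le_mul' ?_
  obtain ⟨F, N, hFm, hF0, hN, hgrad, hnorm⟩ :=
    exists_isBallGrad_of_mem_ballGrads hΩ.measurableSet hg
  obtain ⟨f, N', hfm, hf0, hN', hfv, hfnorm⟩ :=
    exists_measurable_extension_abs hΩ.measurableSet hv.1
  rw [← hnorm, ← hfnorm]
  by_cases htop : eLpNorm F (ENNReal.ofReal q) volume + eLpNorm f (ENNReal.ofReal q) volume = ∞
  · rw [htop, ENNReal.mul_top hD0]
    exact le_top
  -- Adding `f`, which is `|v|` on `Ω` off a null set, gives a gradient that dominates the function,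
  -- as the global Morrey inequality requires; its norm is bounded by the two parts of the
  -- inhomogeneous norm.
  set G : E n → ℝ := F + f with hG
  have hGm : Measurable G := hFm.add hfm
  have hG0 : ∀ x, 0 ≤ G x := fun x => add_nonneg (hF0 x) (hf0 x)
  have hq1 : 1 ≤ ENNReal.ofReal q := by
    rw [← ENNReal.ofReal_one]; exact ENNReal.ofReal_le_ofReal (by linarith)
  have hGle : eLpNorm G (ENNReal.ofReal q) volume ≤
      eLpNorm F (ENNReal.ofReal q) volume + eLpNorm f (ENNReal.ofReal q) volume :=
    eLpNorm_add_le hFm.aestronglyMeasurable hfm.aestronglyMeasurable hq1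
  have hGq : MemLp G (ENNReal.ofReal q) volume :=
    ⟨hGm.aestronglyMeasurable, hGle.trans_lt (lt_top_iff_ne_top.2 htop)⟩
  have hGloc := memLp_restrict_ball hσq.le hGq
  obtain ⟨m, hmm, hm0, hmn, hmae⟩ := hmax G hGm hGq
  rw [ae_iff] at hmae
  set Z := {z | ¬∀ ρ : ℝ, 0 < ρ → locNorm σ G z ρ ≤ ρ ^ ((n : ℝ) / σ) * m z} with hZ
  have hNN : volume (N ∪ N') = 0 := measure_union_null hN hN'
  have hsub : Ω \ (N ∪ N') ⊆ Ω \ N := Set.sdiff_subset_sdiff_right Set.subset_union_left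
  have hgradG : IsBallGrad t Ω (N ∪ N') v G := fun x hx y hy hxy => by
    refine (hgrad x (hsub hx) y (hsub hy) hxy).trans ?_
    have := hf0 x
    have := hf0 y
    simp only [hG, Pi.add_apply]
    gcongr <;> linarith
  have hvG : ∀ x ∈ Ω \ (N ∪ N'), |v x| ≤ G x := fun x hx => by
    rw [← hfv x ⟨hx.1, fun h => hx.2 (Or.inr h)⟩]
    simp only [hG, Pi.add_apply]
    linarith [hF0 x]
  obtain ⟨hpair, hsup⟩ := hmor (N ∪ N') v G hNN hv.1 hGm hGloc hG0 hgradG hvG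
  have hSne := nonempty_diff_of_null hΩ hne hNN
  obtain ⟨U, hUv, hUy, hUm⟩ := hext (Ω \ (N ∪ N')) v G hSne hGm hGloc hG0 hpair
  have hUineq : ∀ z ∉ Z, ∀ w ∉ Z, |U z - U w| ≤ dist z w ^ t * (C' * m z + C' * m w) :=
    fun z hz w hw => hUm m z w (not_not.1 hz) (not_not.1 hw) (hm0 z) (hm0 w)
  have hUsup : ∀ z ∉ Z, (∃ y ∈ Ω \ (N ∪ N'), dist z y < 1) → |U z| ≤ C₆ * m z := by
    rintro z hz ⟨y, hy, hzy⟩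
    -- This radius covers both the ball of radius `R` about a point `y` within distance `1` of `z`
    -- and the ball of radius at most `R'` about `z` from the extension estimate.
    set L := locNorm σ G z (R + 1 + R') with hL
    have hL0 : 0 ≤ L := locNorm_nonneg _ _ _ _
    have h1 : |v y| ≤ C * L := by
      refine (hsup y hy).trans ?_
      gcongr
      exact locNorm_mono (hGloc _ _) (by rw [dist_comm]; linarith)
    have h2 : |U z - v y| ≤ C' * L := by
      refine (hUy z y hy).trans ?_
      have h3 : locNorm σ G z (R' * dist z y) ≤ L := by
        refine locNorm_mono (hGloc _ _) ?_
        have : R' * dist z y ≤ R' * 1 := by gcongr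
        rw [dist_self]
        linarith
      have h4 : dist z y ^ (s - n / p) ≤ 1 := Real.rpow_le_one dist_nonneg hzy.le hα.le
      have := locNorm_nonneg σ G z (R' * dist z y)
      calc _ ≤ C' * 1 * L := by gcongr
        _ = _ := by ring
    have h5 : L ≤ (R + 1 + R') ^ ((n : ℝ) / σ) * m z := not_not.1 hz _ (by positivity)
    have h6 := abs_sub_abs_le_abs_sub (U z) (v y)
    calc |U z| ≤ (C + C') * L := by linarith
      _ ≤ (C + C') * ((R + 1 + R') ^ ((n : ℝ) / σ) * m z) := by gcongr
      _ = _ := by rw [hC₆]; ring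
  obtain ⟨W, hWU, hWsup, hWineq⟩ := exists_cutoff_hajlasz ht ht1 hC₆0 hSne hm0 hC'.le hUineq hUsup
  have hm' : Measurable fun x => (C' + C₆) * m x := hmm.const_mul _
  have hWnorm : inhomBallNorm t (ENNReal.ofReal q) Set.univ W ≤ D *
      (eLpNorm F (ENNReal.ofReal q) volume + eLpNorm f (ENNReal.ofReal q) volume) := by
    have h1 := homBallNorm_le_of_hajlasz (p := ENNReal.ofReal q) hm'
      (fun x => mul_nonneg (by positivity) (hm0 x)) hmae hWineq
    rw [eLpNorm_const_mul_of_nonneg (by positivity)] at h1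
    have h2 : eLpNorm W (ENNReal.ofReal q) (volume.restrict Set.univ) ≤
        ENNReal.ofReal C₆ * eLpNorm m (ENNReal.ofReal q) volume := by
      rw [Measure.restrict_univ, ← eLpNorm_const_mul_of_nonneg hC₆0]
      refine eLpNorm_mono_ae_real ?_
      have : ∀ᵐ z, z ∉ Z := by
        rw [ae_iff]
        simpa using hmae
      filter_upwards [this] with z hz using hWsup z hz
    refine (add_le_add h1 h2).trans ?_
    rw [← add_mul, ← ENNReal.ofReal_add (by positivity) hC₆0]
    refine (mul_le_mul_right (hmn.trans (mul_le_mul_right hGle _)) _).trans ?_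
    rw [← mul_assoc, hD, ENNReal.coe_add, ENNReal.coe_mul]
    gcongr
    exact le_self_add
  have hWmeas := aestronglyMeasurable_of_hajlasz ht hm' hmae hWineq
  have hWmem : Mem (inhomBallNorm t (ENNReal.ofReal q)) Set.univ W :=
    ⟨by rwa [Measure.restrict_univ], hWnorm.trans_lt
      (ENNReal.mul_lt_top ENNReal.coe_lt_top (lt_top_iff_ne_top.2 htop))⟩
  exact (iInf₂_le W ⟨hWmem, ae_restrict_eq_of_forall_diff hΩ.measurableSet hNN
    fun y hy => (hWU y hy).trans (hUv y hy)⟩).trans hWnorm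

end HajlaszSobolev

end

theorem theorem4p2 (n : ℕ) (hn : 1 ≤ n) (Ω : Set (HajlaszSobolev.E n))
    (hΩo : IsOpen Ω) (hΩc : IsConnected Ω)
    (s p : ℝ) (hs : 0 < s) (hs1 : s ≤ 1) (hp : (n : ℝ) / s < p) :
    (HajlaszSobolev.IsInhomBallImbeddingDomain s p Ω →
      ∀ t q : ℝ, s ≤ t → t ≤ 1 → (n : ℝ) / t < q → s - (n : ℝ) / p < t - (n : ℝ) / q →
        HajlaszSobolev.IsInhomBallExtensionDomain t q Ω) ∧
    (Bornology.IsBounded Ω → HajlaszSobolev.IsHomBallImbeddingDomain s p Ω →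
      ∀ t q : ℝ, s ≤ t → t ≤ 1 → (n : ℝ) / t < q → s - (n : ℝ) / p < t - (n : ℝ) / q →
        HajlaszSobolev.IsHomBallExtensionDomain t q Ω) :=
  ⟨fun h _ _ hst ht1 hq hlt =>
    h.isInhomBallExtensionDomain hn hΩo hΩc.nonempty hs hs1 hp hst ht1 hq hlt,
  fun _ h _ _ hst ht1 hq hlt =>
    h.isHomBallExtensionDomain hn hΩo hΩc.nonempty hs hs1 hp hst ht1 hq hlt⟩
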